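/- Let $\operatorname{sinc}(t)=\frac{\sin t}{t}$ for $t\neq 0$ and $\operatorname{sinc}(0)=1$, and let $\ln$ be the principal branch of the logarithm. For $0<s<1$ and $w\in\mathbb{C}\setminus[-1,1]$ put $$Q_s(w)=\frac{w}{w^2-1}\,\exp\Big(-\tfrac12\ln\frac{w^2}{w^2-1}\Big)\,\exp\Big(\frac{i}{2\pi}\ln\big(\tfrac1s-1\big)\,\ln\frac{w-1}{w+1}\Big).$$ Let $0<s<1$ and $b>0$. Then for every real $x\neq 0$ the improper integral $$q_s^+(x)=(2\pi)^{-1/2}\int_{-\infty+ib}^{\infty+ib}e^{-ixw}\,Q_s(w)\,dw=(2\pi)^{-1/2}\lim_{A,A'\to\infty}\int_{-A+ib}^{A'+ib}e^{-ixw}\,Q_s(w)\,dw$$ converges, and its value does not depend on $b>0$. Let $q_s$ be the restriction of $q_s^+$ to $(0,\infty)$. For every $x>0$ the function $y\mapsto\frac1\pi\operatorname{sinc}(x-y)\,q_s(y)$ is integrable on $(0,\infty)$, and $$\int_0^\infty \frac1\pi\operatorname{sinc}(x-y)\,q_s(y)\,dy = s\,q_s(x).$$ Moreover $q_s$ is not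 identically zero on $(0,\infty)$. Hence $q_s$ is a spectral function (generalized eigenfunction) for the spectral value (generalized eigenvalue) $s$ of the Wiener–Hopf operator $K$ on $L^2(0,\infty)$, $(Kg)(x)=\int_0^\infty\frac1\pi\operatorname{sinc}(x-y)\,g(y)\,dy$; that is, $q_s$ is a nonzero function $u$ on $(0,\infty)$ such that $s\,u(x)-\int_0^\infty\frac1\pi\operatorname{sinc}(x-y)\,u(y)\,dy=0$ for all $x>0$. -/

import Mathlib

open MeasureTheory Filter Topology Set

namespace SincWienerHopf

/-- The explicit function `Q_s(w)`, with the principal branch of the logarithm; it is used for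
`w` off the cut `[-1, 1]`. -/
noncomputable def Q (s : ℝ) (w : ℂ) : ℂ :=
  w / (w ^ 2 - 1) * Complex.exp (-(1 / 2) * Complex.log (w ^ 2 / (w ^ 2 - 1))) *
    Complex.exp (Complex.I / (2 * (Real.pi : ℂ)) * (Real.log (1 / s - 1) : ℂ) *
      Complex.log ((w - 1) / (w + 1)))

/-- The truncated integral `(2π)^(-1/2) ∫ e^{-ixw} Q_s(w) dw` along the horizontal segment from
`-A + ib` to `A' + ib`. -/
noncomputable def qTrunc (b s x A A' : ℝ) : ℂ :=
  ((1 / Real.sqrt (2 * Real.pi) : ℝ) : ℂ) *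
    ∫ u in (-A)..A', Complex.exp (-Complex.I * (x : ℂ) * ((u : ℂ) + (b : ℂ) * Complex.I)) *
      Q s ((u : ℂ) + (b : ℂ) * Complex.I)

/-- `q_s^+(x)`: the improper integral `(2π)^(-1/2) ∫ e^{-ixw} Q_s(w) dw` along the whole line
`Im w = b`, both end points tending to infinity independently. The integral converges only
conditionally, so it is a limit of integrals over segments. -/
noncomputable def qPlus (b s x : ℝ) : ℂ :=
  limUnder (atTop ×ˢ atTop : Filter (ℝ × ℝ)) (fun p => qTrunc b s x p.1 p.2)

/-- The kernel `(1/π) sinc` of the Wiener-Hopf operator `K`. -/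
noncomputable def sincKernel (x : ℝ) : ℝ := 1 / Real.pi * Real.sinc x

/-- `u`, of which only the values on `(0, ∞)` matter, is a spectral function (generalized
eigenfunction) for the spectral value (generalized eigenvalue) `s` of the Wiener-Hopf operator with
kernel `k`: a nonzero solution of `s u(x) - ∫₀^∞ k(x - y) u(y) dy = 0`, `x > 0`, where the integral
exists for every `x > 0`. -/
def IsSpectralFunction (k : ℝ → ℝ) (s : ℝ) (u : ℝ → ℂ) : Prop :=
  (∃ x : ℝ, 0 < x ∧ u x ≠ 0) ∧
    ∀ x : ℝ, 0 < x →
      IntegrableOn (fun y => (k (x - y) : ℂ) * u y) (Ioi 0) ∧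
        (s : ℂ) * u x - ∫ y in Ioi (0 : ℝ), (k (x - y) : ℂ) * u y = 0

end SincWienerHopf

/-!
Put `τ = ln (1/s - 1) / (2π)`. The function `Q_s` is analytic off `[-1, 1]`, behaves like `1/w` at
infinity, and its boundary values on the two sides of the cut satisfy `Q₊ = s (Q₊ - Q₋)`. So `q_s`
is, for `x > 0`, the Fourier transform of the jump `Q₊ - Q₋`, while the operator `K`, whose kernel
is the inverse Fourier transform of the indicator function of `[-1, 1]`, turns `q_s` into the
Fourier transform of `Q₊` over `[-1, 1]`. The jump relation makes the latter `s q_s`.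

Contour deformation is replaced by a Cauchy integral. With `u(v) = (1 - e^v) / (1 + e^v)` (`cutPoint`)
as parameter on the cut, the jump becomes a constant times the integrable smooth density
`ρ(v) = e^{av} / (1 + e^v)`, `a = 1/2 + iτ` (`cutDensity`), and in the upper half-plane
`Q_s(w) = (sin πa / π) ∫ ρ(v) / (w - u(v)) dv` (`Q_eq_cauchy_integral`). This is the Stieltjes
transform of `t ^ (a - 1)` (`integral_exp_div_exp_add`) at the point `(w - 1) / (w + 1)`.

By Fubini and dominated convergence the improper integral of `e^{-ixw} Q_s(w)` reduces to that of
`e^{-ixw} / (w - c)` with `c` real, which an integration by parts and Fourier inversion evaluate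
(`tendsto_integral_cexp_div`). Hence `q_s(x)` is, for `x > 0`, a nonzero multiple of
`F(x) = ∫ ρ(v) e^{-ixu(v)} dv` (`cutTransform`), and `q_s^+` vanishes for `x < 0`.

An integration by parts gives `F(x) = O(x^{-1/2})` (`exists_norm_cutTransform_le`), so
`y ↦ sinc (x - y) F(y)` is integrable. After insertion of `e^{-εy}`, Fubini turns the integral of
`sinc (x - y) F(y) / π` into that of `e^{-irx} Q_s(r + iε)` over `[-1, 1]`, up to a constant; as
`ε → 0` the boundary value `Q₊` appears, and the substitution `r = u(v)` brings back `F(x)`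
(`tendsto_integral_Q_cut`) with total factor `s` (`jump_constant`). Finally `F` is continuous and
`F(0) = ∫ ρ ≠ 0`, so `q_s` is not identically zero.
-/

namespace SincWienerHopf

open scoped FourierTransform

/-! ### The Stieltjes transform of a complex power -/

/-- The density `e^{av} / (1 + e^v)`, where `a = 1/2 + iτ`. -/
noncomputable def cutDensity (τ : ℝ) (v : ℝ) : ℂ :=
  Complex.exp ((1 / 2 + τ * Complex.I) * v) / (1 + Real.exp v : ℝ)

/-- The point `(1 - e^v) / (1 + e^v) = -tanh (v / 2)`. -/
noncomputable def cutPoint (v : ℝ) : ℝ := (1 - Real.exp v) / (1 + Real.exp v)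

theorem continuous_cutDensity (τ : ℝ) : Continuous (cutDensity τ) := by
  unfold cutDensity
  refine Continuous.div (by fun_prop) (by fun_prop) fun v => ?_
  exact_mod_cast (by positivity : (1 + Real.exp v) ≠ 0)

theorem continuous_cutPoint : Continuous cutPoint := by
  unfold cutPoint
  exact Continuous.div (by fun_prop) (by fun_prop) fun v => by positivity

theorem norm_cutDensity (τ v : ℝ) :
    ‖cutDensity τ v‖ = Real.exp (v / 2) / (1 + Real.exp v) := by
  have h : ((1 / 2 + τ * Complex.I) * (v : ℂ)).re = v / 2 := by simp; ring
  rw [cutDensity, norm_div, Complex.norm_exp, h, Complex.norm_real, Real.norm_of_nonneg (by positivity)]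

theorem exp_half_div_le_exp_neg_abs (v : ℝ) :
    Real.exp (v / 2) / (1 + Real.exp v) ≤ Real.exp (-(1 / 2) * |v|) := by
  rw [div_le_iff₀ (by positivity), mul_add, mul_one, ← Real.exp_add]
  rcases abs_cases v with ⟨h, h'⟩ | ⟨h, h'⟩ <;> rw [h]
  · have : -(1 / 2) * v + v = v / 2 := by ring
    rw [this]; linarith [Real.exp_pos (-(1 / 2) * v)]
  · have : -(1 / 2) * -v = v / 2 := by ring
    rw [this]; linarith [Real.exp_pos (v / 2 + v)]

theorem integrable_exp_neg_abs : Integrable fun v : ℝ => Real.exp (-(1 / 2) * |v|) := by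
  have h1 : IntegrableOn (fun v : ℝ => Real.exp (-(1 / 2) * |v|)) (Ioi 0) :=
    (integrableOn_exp_mul_Ioi (a := -(1 / 2)) (by norm_num) 0).congr_fun
      (fun v hv => by simp only [abs_of_pos (mem_Ioi.1 hv)]) measurableSet_Ioi
  have h2 : IntegrableOn (fun v : ℝ => Real.exp (-(1 / 2) * |v|)) (Iic 0) :=
    (integrableOn_exp_mul_Iic (a := 1 / 2) (by norm_num) 0).congr_fun
      (fun v hv => by simp only [abs_of_nonpos (mem_Iic.1 hv)]; congr 1; ring) measurableSet_Iic
  rw [← integrableOn_univ, ← Iic_union_Ioi (a := (0 : ℝ))]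
  exact h2.union h1

theorem integrable_exp_half_div :
    Integrable fun v : ℝ => Real.exp (v / 2) / (1 + Real.exp v) := by
  refine integrable_exp_neg_abs.mono' ?_ (ae_of_all _ fun v => ?_)
  · refine (Continuous.div (by fun_prop) (by fun_prop) fun v => ?_).aestronglyMeasurable
    positivity
  · rw [Real.norm_of_nonneg (by positivity)]
    exact exp_half_div_le_exp_neg_abs v

theorem integrable_cutDensity (τ : ℝ) : Integrable (cutDensity τ) :=
  integrable_exp_half_div.mono' (continuous_cutDensity τ).aestronglyMeasurable
    (ae_of_all _ fun v => (norm_cutDensity τ v).le)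

/-- The Beta integral `B(a, 1 - a)` in the logistic variable `v`, together with Euler's reflection
formula. -/
theorem integral_cutDensity (τ : ℝ) :
    ∫ v, cutDensity τ v = Real.pi / Complex.sin (Real.pi * (1 / 2 + τ * Complex.I)) := by
  have ha : (1 / 2 + τ * Complex.I : ℂ).re = 1 / 2 := by simp
  have hb : (1 - (1 / 2 + τ * Complex.I) : ℂ).re = 1 / 2 := by simp; norm_num
  rw [← Complex.Gamma_mul_Gamma_one_sub, Complex.Gamma_mul_Gamma_eq_betaIntegral
    (by rw [ha]; norm_num) (by rw [hb]; norm_num), add_sub_cancel, Complex.Gamma_one, one_mul,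
    Complex.betaIntegral, intervalIntegral.integral_of_le zero_le_one,
    ← setIntegral_congr_set Ioo_ae_eq_Ioc, ← Real.range_sigmoid, ← image_univ,
    integral_image_eq_integral_abs_deriv_smul MeasurableSet.univ
      (fun x _ => (Real.hasDerivAt_sigmoid x).hasDerivWithinAt) Real.sigmoid_injective.injOn,
    setIntegral_univ]
  congr 1
  ext v
  set a : ℂ := 1 / 2 + τ * Complex.I with ha'
  have h1 : 0 < 1 - Real.sigmoid v := by linarith [Real.sigmoid_lt_one v]
  have h2 := Real.sigmoid_pos v
  have hl : Real.log (Real.sigmoid v) - Real.log (1 - Real.sigmoid v) = v := by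
    rw [← Real.sigmoid_neg, ← Real.sigmoid_mul_rexp_neg, Real.log_mul h2.ne' (Real.exp_ne_zero _),
      Real.log_exp]
    ring
  have h3 : ((1 + Real.exp v : ℝ) : ℂ)⁻¹ = (1 - Real.sigmoid v : ℝ) := by
    rw [← Real.sigmoid_neg, Real.sigmoid_def, neg_neg]; push_cast; rfl
  have h4 : Complex.exp (a * v) = (Real.sigmoid v : ℂ) ^ a * ((1 - Real.sigmoid v : ℝ) : ℂ) ^ (-a) := by
    rw [Complex.cpow_def_of_ne_zero (by exact_mod_cast h2.ne'),
      Complex.cpow_def_of_ne_zero (by exact_mod_cast h1.ne'), ← Complex.exp_add,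
      ← Complex.ofReal_log h1.le, ← Complex.ofReal_log h2.le]
    congr 1
    have hlc := congrArg (fun t : ℝ => (t : ℂ)) hl
    push_cast at hlc ⊢
    linear_combination (-a) * hlc
  rw [cutDensity, div_eq_mul_inv, h3, ← ha', h4, abs_of_pos (mul_pos h2 h1), Complex.real_smul,
    Complex.cpow_sub _ _ (by exact_mod_cast h2.ne'), Complex.cpow_one]
  have : (1 : ℂ) - a - 1 = -a := by ring
  rw [this]
  have h5 : (Real.sigmoid v : ℂ) ≠ 0 := by exact_mod_cast h2.ne'
  push_cast
  field_simp

theorem sq_norm_ofReal_add (t : ℝ) (z : ℂ) :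
    ‖(t : ℂ) + z‖ ^ 2 = t ^ 2 + 2 * t * z.re + ‖z‖ ^ 2 := by
  rw [Complex.sq_norm, Complex.sq_norm, Complex.normSq_apply, Complex.normSq_apply]
  simp; ring

/-- With `z = |z| e^{iθ}`, the constant is `cos (θ / 2) min(1, |z|)`. -/
theorem exists_mul_le_norm_ofReal_add {z : ℂ} (hz : z ∈ Complex.slitPlane) :
    ∃ c > 0, ∀ t : ℝ, 0 ≤ t → c * (1 + t) ≤ ‖(t : ℂ) + z‖ := by
  have hr : 0 < ‖z‖ := norm_pos_iff.2 (Complex.slitPlane_ne_zero hz)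
  have hre : 0 < ‖z‖ + z.re := by
    rcases Complex.mem_slitPlane_iff.1 hz with h | h
    · linarith
    · have := Complex.abs_re_lt_norm.2 h
      linarith [neg_abs_le z.re]
  -- `k = cos (θ / 2) ^ 2`
  set k := (‖z‖ + z.re) / (2 * ‖z‖) with hk
  have hk0 : 0 < k := by positivity
  have hkz : 2 * ‖z‖ * k = ‖z‖ + z.re := by rw [hk]; field_simp
  refine ⟨Real.sqrt k * min 1 ‖z‖, by positivity, fun t ht => ?_⟩
  have h1 : Real.sqrt k * (t + ‖z‖) ≤ ‖(t : ℂ) + z‖ := by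
    refine abs_le_of_sq_le_sq' ?_ (norm_nonneg _) |>.2
    rw [mul_pow, Real.sq_sqrt hk0.le, sq_norm_ofReal_add]
    have hk1 : k ≤ 1 := by
      rw [hk, div_le_one (by positivity)]; linarith [Complex.re_le_norm z]
    have : z.re = 2 * ‖z‖ * k - ‖z‖ := by linarith
    rw [this]
    nlinarith [mul_nonneg (sub_nonneg.2 hk1) (sq_nonneg (t - ‖z‖))]
  refine le_trans ?_ h1
  rw [mul_assoc]
  gcongr
  have h2 : min 1 ‖z‖ ≤ 1 := min_le_left _ _
  have h3 : min 1 ‖z‖ ≤ ‖z‖ := min_le_right _ _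
  nlinarith

theorem differentiableAt_stieltjes (τ : ℝ) {z₀ : ℂ} (hz : z₀ ∈ Complex.slitPlane) :
    DifferentiableAt ℂ (fun z => ∫ v : ℝ, Complex.exp ((1 / 2 + τ * Complex.I) * v) /
      ((Real.exp v : ℝ) + z)) z₀ := by
  obtain ⟨c, hc, hcz⟩ := exists_mul_le_norm_ofReal_add hz
  have key : ∀ z ∈ Metric.ball z₀ (c / 2), ∀ v : ℝ,
      c / 2 * (1 + Real.exp v) ≤ ‖((Real.exp v : ℝ) : ℂ) + z‖ := fun z hz v => by
    have h1 := hcz (Real.exp v) (Real.exp_pos v).le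
    rw [mem_ball_iff_norm] at hz
    have h2 : ‖((Real.exp v : ℝ) : ℂ) + z₀‖ ≤ ‖((Real.exp v : ℝ) : ℂ) + z‖ + ‖z - z₀‖ := by
      have := norm_sub_le (((Real.exp v : ℝ) : ℂ) + z) (z - z₀)
      rwa [show ((Real.exp v : ℝ) : ℂ) + z - (z - z₀) = (Real.exp v : ℝ) + z₀ by ring] at this
    nlinarith [Real.exp_pos v]
  have hne : ∀ z ∈ Metric.ball z₀ (c / 2), ∀ v : ℝ, ((Real.exp v : ℝ) : ℂ) + z ≠ 0 :=
    fun z hz v => norm_pos_iff.1 (lt_of_lt_of_le (by positivity) (key z hz v))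
  have hball : Metric.ball z₀ (c / 2) ∈ 𝓝 z₀ := Metric.ball_mem_nhds _ (by positivity)
  have hz₀ : z₀ ∈ Metric.ball z₀ (c / 2) := Metric.mem_ball_self (by positivity)
  have hnum : ∀ v : ℝ, ‖Complex.exp ((1 / 2 + τ * Complex.I) * v)‖ = Real.exp (v / 2) := fun v => by
    rw [Complex.norm_exp]; congr 1; simp; ring
  have hcont : ∀ z ∈ Metric.ball z₀ (c / 2), Continuous fun v : ℝ =>
      Complex.exp ((1 / 2 + τ * Complex.I) * v) / ((Real.exp v : ℝ) + z) := fun z hz =>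
    Continuous.div (by fun_prop) (by fun_prop) (hne z hz)
  refine (hasDerivAt_integral_of_dominated_loc_of_deriv_le (μ := volume)
    (F' := fun z v => -Complex.exp ((1 / 2 + τ * Complex.I) * v) / ((Real.exp v : ℝ) + z) ^ 2)
    (bound := fun v => (c / 2)⁻¹ ^ 2 * (Real.exp (v / 2) / (1 + Real.exp v)))
    hball ?_ ?_ ?_ ?_ ?_ ?_).2.differentiableAt
  · filter_upwards [hball] with z hz using (hcont z hz).aestronglyMeasurable
  · refine (integrable_exp_half_div.const_mul (c / 2)⁻¹).mono' (hcont z₀ hz₀).aestronglyMeasurable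
      (ae_of_all _ fun v => ?_)
    rw [norm_div, hnum]
    calc _ ≤ Real.exp (v / 2) / (c / 2 * (1 + Real.exp v)) := by gcongr; exact key z₀ hz₀ v
      _ = _ := by field_simp
  · exact (Continuous.div (by fun_prop) (by fun_prop)
      fun v => pow_ne_zero 2 (hne z₀ hz₀ v)).aestronglyMeasurable
  · refine ae_of_all _ fun v z hz => ?_
    rw [norm_div, norm_neg, hnum, norm_pow, div_eq_mul_inv (Real.exp _),
      div_eq_mul_inv (Real.exp _), mul_left_comm, ← inv_pow]
    have h1 : (‖((Real.exp v : ℝ) : ℂ) + z‖)⁻¹ ≤ (c / 2 * (1 + Real.exp v))⁻¹ := by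
      gcongr; exact key z hz v
    have h2 : (1 + Real.exp v)⁻¹ ≤ 1 := inv_le_one_of_one_le₀ (by linarith [Real.exp_pos v])
    have h3 : 0 < (1 + Real.exp v)⁻¹ := by positivity
    gcongr
    calc _ ≤ ((c / 2 * (1 + Real.exp v))⁻¹) ^ 2 := by gcongr
      _ = (c / 2)⁻¹ ^ 2 * ((1 + Real.exp v)⁻¹ * (1 + Real.exp v)⁻¹) := by rw [mul_inv]; ring
      _ ≤ (c / 2)⁻¹ ^ 2 * ((1 + Real.exp v)⁻¹ * 1) := by gcongr
      _ = _ := by ring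
  · exact integrable_exp_half_div.const_mul _
  · refine ae_of_all _ fun v z hz => ?_
    have := ((hasDerivAt_id z).const_add ((Real.exp v : ℝ) : ℂ)).fun_inv (hne z hz v)
    simpa [div_eq_mul_inv] using this.const_mul (Complex.exp ((1 / 2 + τ * Complex.I) * v))

/-- The Stieltjes transform of `t ^ (a - 1)`, in the variable `t = e^v`. For `z > 0` the formula
follows from the case `z = 1` by a translation of `v`; both sides are analytic on the slit plane. -/
theorem integral_exp_div_exp_add (τ : ℝ) {z : ℂ} (hz : z ∈ Complex.slitPlane) :
    ∫ v : ℝ, Complex.exp ((1 / 2 + τ * Complex.I) * v) / ((Real.exp v : ℝ) + z) =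
      Real.pi / Complex.sin (Real.pi * (1 / 2 + τ * Complex.I)) *
        Complex.exp ((-(1 / 2) + τ * Complex.I) * Complex.log z) := by
  have hf : AnalyticOnNhd ℂ (fun z => ∫ v : ℝ, Complex.exp ((1 / 2 + τ * Complex.I) * v) /
      ((Real.exp v : ℝ) + z)) Complex.slitPlane :=
    DifferentiableOn.analyticOnNhd
      (fun z hz => (differentiableAt_stieltjes τ hz).differentiableWithinAt) Complex.isOpen_slitPlane
  have hg : AnalyticOnNhd ℂ (fun z => Real.pi / Complex.sin (Real.pi * (1 / 2 + τ * Complex.I)) *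
        Complex.exp ((-(1 / 2) + τ * Complex.I) * Complex.log z)) Complex.slitPlane :=
    DifferentiableOn.analyticOnNhd (fun z hz => DifferentiableAt.differentiableWithinAt
      (((Complex.differentiableAt_log hz).const_mul _).cexp.const_mul _)) Complex.isOpen_slitPlane
  refine hf.eqOn_of_preconnected_of_frequently_eq hg
    (Complex.starConvex_one_slitPlane.isPathConnected
      Complex.one_mem_slitPlane).isConnected.isPreconnected (z₀ := 1) (by simp) ?_ hz
  have hpos : ∀ r : ℝ, 0 < r → ∫ v : ℝ, Complex.exp ((1 / 2 + τ * Complex.I) * v) /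
      ((Real.exp v : ℝ) + (r : ℂ)) = Real.pi / Complex.sin (Real.pi * (1 / 2 + τ * Complex.I)) *
        Complex.exp ((-(1 / 2) + τ * Complex.I) * Complex.log r) := fun r hr => by
    rw [← integral_cutDensity, ← integral_mul_const, ← integral_add_right_eq_self _ (Real.log r)]
    congr 1
    ext v
    have hrc : (r : ℂ) ≠ 0 := by exact_mod_cast hr.ne'
    have h0 : (1 + Complex.exp v) ≠ 0 := by
      rw [← Complex.ofReal_exp]; exact_mod_cast (by positivity : (1 + Real.exp v) ≠ 0)
    have h1 : Complex.exp (Complex.log r) = r := Complex.exp_log hrc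
    have h2 : Complex.exp ((1 / 2 + τ * Complex.I) * ((v + Real.log r : ℝ) : ℂ)) =
        Complex.exp ((1 / 2 + τ * Complex.I) * v) *
          (Complex.exp ((-(1 / 2) + τ * Complex.I) * Complex.log r) * Complex.exp (Complex.log r)) := by
      rw [← Complex.exp_add, ← Complex.exp_add, ← Complex.ofReal_log hr.le]
      congr 1; push_cast; ring
    rw [h2, h1, Real.exp_add, Real.exp_log hr, cutDensity]
    push_cast
    rw [show Complex.exp v * r + r = (1 + Complex.exp v) * r by ring]
    field_simp
  -- the points `1 + 1 / (n + 1)` accumulate at `1`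
  have ht : Tendsto (fun n : ℕ => ((1 + 1 / ((n : ℝ) + 1) : ℝ) : ℂ)) atTop (𝓝[≠] 1) := by
    refine tendsto_nhdsWithin_iff.2 ⟨?_, .of_forall fun n => ?_⟩
    · have h : Tendsto (fun n : ℕ => (1 + 1 / ((n : ℝ) + 1) : ℝ)) atTop (𝓝 (1 + 0)) :=
        tendsto_one_div_add_atTop_nhds_zero_nat.const_add 1
      have := (Complex.continuous_ofReal.tendsto _).comp h
      simpa [Function.comp_def] using this
    · have h : (1 + 1 / ((n : ℝ) + 1) : ℝ) ≠ 1 := by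
        have : 0 < 1 / ((n : ℝ) + 1) := by positivity
        linarith
      rw [mem_compl_singleton_iff]
      exact_mod_cast h
  exact ht.frequently (Frequently.of_forall fun n => hpos _ (by positivity))

/-! ### `Q` as a Cauchy integral over the cut -/

/-- The real exponent `τ = ln (1/s - 1) / (2π)`. -/
noncomputable def spectralExponent (s : ℝ) : ℝ := Real.log (1 / s - 1) / (2 * Real.pi)

/-- The normalizing factor `sin (π a) / π` with `a = 1/2 + iτ`. -/
noncomputable def cutFactor (τ : ℝ) : ℂ :=
  Complex.sin (Real.pi * (1 / 2 + τ * Complex.I)) / Real.pi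

theorem sin_pi_mul_ne_zero (τ : ℝ) :
    Complex.sin (Real.pi * (1 / 2 + τ * Complex.I)) ≠ 0 := by
  have : (Real.pi * (1 / 2 + τ * Complex.I) : ℂ) =
      ((Real.pi * τ : ℝ) : ℂ) * Complex.I + Real.pi / 2 := by push_cast; ring
  rw [this, Complex.sin_add_pi_div_two, Complex.cos_mul_I, ← Complex.ofReal_cosh]
  exact_mod_cast (Real.cosh_pos _).ne'

theorem cutFactor_ne_zero (τ : ℝ) : cutFactor τ ≠ 0 :=
  div_ne_zero (sin_pi_mul_ne_zero τ) (by exact_mod_cast Real.pi_ne_zero)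

theorem cutFactor_mul_integral_cutDensity (τ : ℝ) : cutFactor τ * ∫ v, cutDensity τ v = 1 := by
  rw [integral_cutDensity, cutFactor, div_mul_div_comm, mul_comm, div_self]
  exact mul_ne_zero (by exact_mod_cast Real.pi_ne_zero) (sin_pi_mul_ne_zero τ)

theorem ne_ofReal_of_im_pos {w : ℂ} (hw : 0 < w.im) (r : ℝ) : w - r ≠ 0 := fun h => by
  rw [sub_eq_zero.1 h] at hw; simp at hw

theorem sub_one_ne_zero {w : ℂ} (hw : 0 < w.im) : w - 1 ≠ 0 := by
  simpa using ne_ofReal_of_im_pos hw 1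

theorem add_one_ne_zero {w : ℂ} (hw : 0 < w.im) : w + 1 ≠ 0 := by
  simpa using ne_ofReal_of_im_pos hw (-1)

theorem im_cayley_pos {w : ℂ} (hw : 0 < w.im) : 0 < ((w - 1) / (w + 1)).im := by
  have h : 0 < Complex.normSq (w + 1) := Complex.normSq_pos.2 (add_one_ne_zero hw)
  rw [Complex.div_im]
  simp only [Complex.sub_im, Complex.one_im, sub_zero, Complex.add_re, Complex.one_re,
    Complex.sub_re, Complex.add_im, add_zero]
  rw [← sub_div]
  apply div_pos _ h
  linarith

theorem cayley_mem_slitPlane {w : ℂ} (hw : 0 < w.im) : (w - 1) / (w + 1) ∈ Complex.slitPlane :=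
  Complex.mem_slitPlane_iff.2 (Or.inr (im_cayley_pos hw).ne')

theorem sq_sub_one_ne_zero {w : ℂ} (hw : 0 < w.im) : w ^ 2 - 1 ≠ 0 := by
  rw [show w ^ 2 - 1 = (w - 1) * (w + 1) by ring]
  exact mul_ne_zero (sub_one_ne_zero hw) (add_one_ne_zero hw)

theorem sq_div_mem_slitPlane {w : ℂ} (hw : 0 < w.im) :
    w ^ 2 / (w ^ 2 - 1) ∈ Complex.slitPlane := by
  by_contra h
  rw [Complex.mem_slitPlane_iff, not_or, not_lt, not_not] at h
  obtain ⟨h1, h2⟩ := h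
  set r := (w ^ 2 / (w ^ 2 - 1)).re with hr
  have h3 : w ^ 2 / (w ^ 2 - 1) = (r : ℂ) := Complex.ext (by simp [hr]) (by simp [h2])
  rw [div_eq_iff (sq_sub_one_ne_zero hw)] at h3
  have h4 : w ^ 2 * (1 - r : ℝ) = (-r : ℝ) := by push_cast; linear_combination h3
  have him := congrArg Complex.im h4
  have hre := congrArg Complex.re h4
  rw [Complex.im_mul_ofReal, Complex.ofReal_im, mul_eq_zero_iff_right (by linarith)] at him
  rw [Complex.re_mul_ofReal, Complex.ofReal_re] at hre
  simp only [pow_two, Complex.mul_im, Complex.mul_re] at him hre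
  have h5 : w.re = 0 := by
    have : w.re * w.im = 0 := by linarith
    exact (mul_eq_zero.1 this).resolve_right hw.ne'
  rw [h5] at hre
  nlinarith [mul_pos hw hw]

/-- Both sides are square roots of `1 / (w ^ 2 - 1)`, so they agree up to a sign that is constant
on the upper half-plane; the sign is found at `w = i`. -/
theorem div_mul_exp_log_eq {w : ℂ} (hw : 0 < w.im) :
    w / (w ^ 2 - 1) * Complex.exp (-(1 / 2) * Complex.log (w ^ 2 / (w ^ 2 - 1))) =
      Complex.exp (-(1 / 2) * Complex.log ((w - 1) / (w + 1))) / (w + 1) := by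
  have hconn : IsPreconnected {w : ℂ | 0 < w.im} := (convex_halfSpace_im_gt 0).isPreconnected
  have hexp : ∀ x : ℂ, x ≠ 0 → Complex.exp (-(1 / 2) * Complex.log x) ^ 2 = x⁻¹ := fun x hx => by
    rw [← Complex.exp_nat_mul, ← Complex.exp_log (inv_ne_zero hx)]
    nth_rewrite 1 [← neg_neg (Complex.log x)]
    rw [Complex.exp_log (inv_ne_zero hx), neg_neg,
      show ((2 : ℕ) : ℂ) * (-(1 / 2) * Complex.log x) = -Complex.log x by push_cast; ring,
      Complex.exp_neg, Complex.exp_log hx]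
  have hne0 : ∀ {w : ℂ}, 0 < w.im → w ≠ 0 := fun hw => by simpa using ne_ofReal_of_im_pos hw 0
  have hsign := hconn.eq_or_eq_neg_of_sq_eq
    (f := fun w => w / (w ^ 2 - 1) * Complex.exp (-(1 / 2) * Complex.log (w ^ 2 / (w ^ 2 - 1))))
    (g := fun w => Complex.exp (-(1 / 2) * Complex.log ((w - 1) / (w + 1))) / (w + 1))
    ?_ ?_ ?_ ?_
  · rcases hsign with h | h
    · exact h hw
    · exfalso
      have hI : (0 : ℝ) < Complex.I.im := by simp
      have h1 := h hI
      have e1 : Complex.I ^ 2 / (Complex.I ^ 2 - 1) = ((1 / 2 : ℝ) : ℂ) := by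
        rw [Complex.I_sq]; push_cast; norm_num
      have e2 : (Complex.I - 1) / (Complex.I + 1) = Complex.I := by
        rw [div_eq_iff (add_one_ne_zero hI)]; linear_combination -Complex.I_sq
      have e3 : (-(1 / 2) * (Real.pi / 2 * Complex.I) : ℂ) = ((-(Real.pi / 4) : ℝ) : ℂ) * Complex.I := by
        push_cast; ring
      simp only [Pi.neg_apply, e1, e2, Complex.log_I, e3, Complex.exp_mul_I, ← Complex.ofReal_cos,
        ← Complex.ofReal_sin, Real.cos_neg, Real.sin_neg, Real.cos_pi_div_four,
        Real.sin_pi_div_four] at h1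
      rw [← Complex.ofReal_log (by norm_num),
        show (-(1 / 2) * (Real.log (1 / 2) : ℝ) : ℂ) = ((-(1 / 2) * Real.log (1 / 2) : ℝ) : ℂ) by
          push_cast; ring, ← Complex.ofReal_exp, ← neg_div (Complex.I + 1),
        eq_div_iff (add_one_ne_zero hI)] at h1
      set r := Real.exp (-(1 / 2) * Real.log (1 / 2)) with hr
      have hr0 : 0 < r := Real.exp_pos _
      have h2 := congrArg Complex.re h1
      rw [show Complex.I / (Complex.I ^ 2 - 1) = ((-(1 / 2) : ℝ) : ℂ) * Complex.I by
        rw [Complex.I_sq]; push_cast; ring] at h2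
      simp at h2
      have : 0 < Real.sqrt 2 := by positivity
      linarith
  · intro w hw
    refine ContinuousAt.continuousWithinAt ?_
    have h2 := sq_sub_one_ne_zero hw
    have h3 : ContinuousAt (fun w : ℂ => w ^ 2 / (w ^ 2 - 1)) w := by fun_prop (disch := assumption)
    exact (ContinuousAt.div (f := fun w : ℂ => w) (g := fun w : ℂ => w ^ 2 - 1)
      (by fun_prop) (by fun_prop) h2).mul
      (continuousAt_const.mul (h3.clog (sq_div_mem_slitPlane hw))).cexp
  · intro w hw
    refine ContinuousAt.continuousWithinAt ?_
    have h2 := add_one_ne_zero hw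
    have h3 : ContinuousAt (fun w : ℂ => (w - 1) / (w + 1)) w := by fun_prop (disch := assumption)
    exact ContinuousAt.div (g := fun w : ℂ => w + 1)
      (continuousAt_const.mul (h3.clog (cayley_mem_slitPlane hw))).cexp (by fun_prop) h2
  · intro w hw
    have h0 := hne0 hw
    have h1 := sub_one_ne_zero hw
    have h2 := add_one_ne_zero hw
    have h3 := sq_sub_one_ne_zero hw
    simp only [Pi.pow_apply, mul_pow, div_pow]
    rw [hexp _ (div_ne_zero (pow_ne_zero 2 h0) h3), hexp _ (div_ne_zero h1 h2), inv_div, inv_div,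
      show w ^ 2 - 1 = (w - 1) * (w + 1) by ring]
    field_simp
  · intro w hw
    exact div_ne_zero (Complex.exp_ne_zero _) (add_one_ne_zero hw)

theorem Q_eq_exp_log_cayley (s : ℝ) {w : ℂ} (hw : 0 < w.im) :
    Q s w = Complex.exp ((-(1 / 2) + spectralExponent s * Complex.I) *
      Complex.log ((w - 1) / (w + 1))) / (w + 1) := by
  rw [Q, div_mul_exp_log_eq hw, div_mul_eq_mul_div, ← Complex.exp_add, spectralExponent]
  congr 2
  push_cast
  ring

/-- `Q` is the Cauchy transform of its jump across the cut, here pulled back to the real line. -/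
theorem Q_eq_cauchy_integral (s : ℝ) {w : ℂ} (hw : 0 < w.im) :
    Q s w = cutFactor (spectralExponent s) *
      ∫ v, cutDensity (spectralExponent s) v / (w - cutPoint v) := by
  have h2 := add_one_ne_zero hw
  have key : ∀ v : ℝ, cutDensity (spectralExponent s) v / (w - cutPoint v) =
      Complex.exp ((1 / 2 + spectralExponent s * Complex.I) * v) /
      ((Real.exp v : ℝ) + (w - 1) / (w + 1)) / (w + 1) := fun v => by
    have h0 : (1 + Complex.exp v) ≠ 0 := by
      rw [← Complex.ofReal_exp]; exact_mod_cast (by positivity : (1 + Real.exp v) ≠ 0)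
    rw [cutDensity, cutPoint, div_div, div_div]
    congr 1
    push_cast
    field_simp
    ring
  simp_rw [key]
  rw [integral_div, integral_exp_div_exp_add _ (cayley_mem_slitPlane hw), Q_eq_exp_log_cayley s hw,
    mul_div_assoc, ← mul_assoc, ← integral_cutDensity, cutFactor_mul_integral_cutDensity, one_mul]

/-! ### Fourier integrals of a single and a double pole -/

theorem mul_exp_neg_le {b : ℝ} (hb : 0 < b) (y : ℝ) :
    y * Real.exp (-b * y) ≤ 2 / b * Real.exp (-(b / 2) * y) := by
  have h : b / 2 * y ≤ Real.exp (b / 2 * y) := by linarith [Real.add_one_le_exp (b / 2 * y)]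
  have h2 : Real.exp (-(b / 2) * y) = Real.exp (b / 2 * y) * Real.exp (-b * y) := by
    rw [← Real.exp_add]; congr 1; ring
  rw [h2, ← mul_assoc]
  gcongr
  rw [div_mul_eq_mul_div, le_div_iff₀ hb]
  linarith

theorem norm_ofReal_mul_cexp {y : ℝ} (hy : 0 ≤ y) (c : ℂ) :
    ‖(y : ℂ) * Complex.exp (-c * y)‖ = y * Real.exp (-c.re * y) := by
  rw [norm_mul, Complex.norm_real, Real.norm_of_nonneg hy, Complex.norm_exp]
  simp

theorem integrableOn_mul_cexp_neg {c : ℂ} (hc : 0 < c.re) :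
    IntegrableOn (fun y : ℝ => (y : ℂ) * Complex.exp (-c * y)) (Ioi 0) := by
  refine Integrable.mono' ((integrableOn_exp_mul_Ioi (a := -(c.re / 2)) (by linarith) 0).const_mul
    (2 / c.re)) (by fun_prop) ?_
  refine (ae_restrict_iff' measurableSet_Ioi).2 (ae_of_all _ fun y hy => ?_)
  rw [norm_ofReal_mul_cexp (le_of_lt hy)]
  exact mul_exp_neg_le hc y

theorem integral_mul_cexp_neg {c : ℂ} (hc : 0 < c.re) :
    ∫ y in Ioi (0 : ℝ), (y : ℂ) * Complex.exp (-c * y) = 1 / c ^ 2 := by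
  have hc0 : c ≠ 0 := fun h => by simp [h] at hc
  have hE : Tendsto (fun y : ℝ => Real.exp (-(c.re / 2) * y)) atTop (𝓝 0) :=
    Real.tendsto_exp_atBot.comp (tendsto_id.const_mul_atTop_of_neg (by linarith))
  have hE1 : Tendsto (fun y : ℝ => (y : ℂ) * Complex.exp (-c * y)) atTop (𝓝 0) := by
    refine squeeze_zero_norm' (a := fun y => 2 / c.re * Real.exp (-(c.re / 2) * y)) ?_
      (by simpa using hE.const_mul (2 / c.re))
    filter_upwards [eventually_ge_atTop 0] with y hy
    rw [norm_ofReal_mul_cexp hy]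
    exact mul_exp_neg_le hc y
  have hE2 : Tendsto (fun y : ℝ => Complex.exp (-c * y)) atTop (𝓝 0) := by
    refine squeeze_zero_norm' ?_ hE
    filter_upwards [eventually_ge_atTop 0] with y hy
    rw [Complex.norm_exp]
    simp
    nlinarith
  rw [integral_Ioi_of_hasDerivAt_of_tendsto' (m := 0)
    (f := fun y : ℝ => -(1 / c) * ((y : ℂ) * Complex.exp (-c * y)) - 1 / c ^ 2 * Complex.exp (-c * y))
    ?_ (integrableOn_mul_cexp_neg hc) ?_]
  · simp
  · intro y _
    have h1 : HasDerivAt (fun y : ℝ => (y : ℂ)) 1 y := Complex.ofRealCLM.hasDerivAt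
    have h2 : HasDerivAt (fun y : ℝ => Complex.exp (-c * y)) (Complex.exp (-c * y) * (-c)) y := by
      have h3 := (h1.const_mul (-c)).cexp
      rwa [mul_one] at h3
    have h3 := ((h1.fun_mul h2).const_mul (-(1 / c))).fun_sub (h2.const_mul (1 / c ^ 2))
    refine h3.congr_deriv ?_
    field_simp
    ring
  · have h3 := (hE1.const_mul (-(1 / c))).sub (hE2.const_mul (1 / c ^ 2))
    rw [mul_zero, mul_zero, sub_zero] at h3
    exact h3

theorem integrable_inv_sq_add_sq {b : ℝ} (hb : 0 < b) :
    Integrable fun t : ℝ => (t ^ 2 + b ^ 2)⁻¹ := by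
  refine ((integrable_inv_one_add_sq.comp_div hb.ne').const_mul ((b ^ 2)⁻¹)).congr
    (ae_of_all _ fun t => ?_)
  simp only []
  rw [← mul_inv]
  congr 1
  field_simp
  ring

theorem norm_cexp_neg_I_mul (x t : ℝ) : ‖Complex.exp (-Complex.I * x * t)‖ = 1 := by
  rw [Complex.norm_exp]; simp

theorem add_mul_I_sub_ne_zero {b : ℝ} (hb : 0 < b) (c t : ℝ) : (t : ℂ) + b * Complex.I - c ≠ 0 :=
  ne_ofReal_of_im_pos (by simpa using hb) c

theorem norm_add_mul_I_sub_sq (b c t : ℝ) :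
    ‖(t : ℂ) + b * Complex.I - c‖ ^ 2 = (t - c) ^ 2 + b ^ 2 := by
  rw [Complex.sq_norm, Complex.normSq_apply]; simp; ring

theorem le_norm_add_mul_I_sub (b c t : ℝ) :
    b ≤ ‖(t : ℂ) + b * Complex.I - c‖ := by
  refine (abs_le_of_sq_le_sq' ?_ (norm_nonneg _)).2
  rw [norm_add_mul_I_sub_sq]
  linarith [sq_nonneg (t - c)]

theorem abs_sub_le_norm_add_mul_I_sub (b c t : ℝ) :
    |t - c| ≤ ‖(t : ℂ) + b * Complex.I - c‖ := by
  refine (abs_le_of_sq_le_sq' ?_ (norm_nonneg _)).2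
  rw [norm_add_mul_I_sub_sq, sq_abs]
  linarith [sq_nonneg b]

theorem norm_cexp_div_sq (b c x t : ℝ) :
    ‖Complex.exp (-Complex.I * x * t) / ((t : ℂ) + b * Complex.I - c) ^ 2‖ =
      ((t - c) ^ 2 + b ^ 2)⁻¹ := by
  rw [norm_div, norm_cexp_neg_I_mul, norm_pow, norm_add_mul_I_sub_sq, one_div]

theorem integrable_cexp_div_sq {b : ℝ} (hb : 0 < b) (c x : ℝ) : Integrable fun t : ℝ =>
    Complex.exp (-Complex.I * x * t) / ((t : ℂ) + b * Complex.I - c) ^ 2 := by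
  refine ((integrable_inv_sq_add_sq hb).comp_sub_right c).mono'
    (Continuous.div (by fun_prop) (by fun_prop)
      fun t => pow_ne_zero 2 (add_mul_I_sub_ne_zero hb c t)).aestronglyMeasurable
    (ae_of_all _ fun t => (norm_cexp_div_sq b c x t).le)

/-- The Fourier integral of a double pole in the lower half-plane, by Fourier inversion of
`y e^{-by}` on the half-line. -/
theorem integral_cexp_div_sq {b : ℝ} (hb : 0 < b) (x : ℝ) :
    ∫ t : ℝ, Complex.exp (-Complex.I * x * t) / ((t : ℂ) + b * Complex.I) ^ 2 =
      -(2 * Real.pi) * ((max x 0 : ℝ) * Complex.exp (-b * x)) := by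
  set h : ℝ → ℂ := fun y => (max y 0 : ℝ) * Complex.exp (-b * y) with hh
  have hcont : Continuous h := by fun_prop
  have hind : ∀ y, h y = (Ioi (0 : ℝ)).indicator (fun y : ℝ => (y : ℂ) * Complex.exp (-b * y)) y := by
    intro y
    by_cases hy : 0 < y
    · rw [indicator_of_mem (mem_Ioi.2 hy)]; simp only [hh, max_eq_left hy.le]
    · rw [indicator_of_notMem (by simpa using hy)]; simp [hh, max_eq_right (not_lt.1 hy)]
  have hint : Integrable h := by
    rw [funext hind, integrable_indicator_iff measurableSet_Ioi]
    exact integrableOn_mul_cexp_neg (c := b) (by simpa using hb)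
  -- the transform is `1 / (b + 2πiξ) ^ 2`, and `b + 2πiξ = -i (-2πξ + ib)`
  have hF : ∀ ξ : ℝ, 𝓕 h ξ = -(1 / (((-(2 * Real.pi) * ξ : ℝ) : ℂ) + b * Complex.I) ^ 2) := by
    intro ξ
    rw [Real.fourier_eq']
    have : (fun v : ℝ => Complex.exp (((-2 * Real.pi * inner ℝ v ξ : ℝ) : ℂ) * Complex.I) • h v) =
        (Ioi (0 : ℝ)).indicator
          (fun y : ℝ => (y : ℂ) * Complex.exp (-(b + 2 * Real.pi * ξ * Complex.I) * y)) := by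
      ext v
      rw [hind v]
      by_cases hv : v ∈ Ioi (0 : ℝ)
      · rw [indicator_of_mem hv, indicator_of_mem hv, smul_eq_mul, mul_left_comm, ← Complex.exp_add]
        congr 2
        simp
        ring
      · rw [indicator_of_notMem hv, indicator_of_notMem hv, smul_zero]
    rw [this, integral_indicator measurableSet_Ioi, integral_mul_cexp_neg (by simpa using hb),
      ← one_div_neg_eq_neg_one_div]
    congr 1
    push_cast
    linear_combination (b ^ 2 + 4 * Real.pi ^ 2 * ξ ^ 2 : ℂ) * Complex.I_sq
  have hsc := Measure.integral_comp_mul_left (fun t : ℝ =>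
    Complex.exp (-Complex.I * x * t) / ((t : ℂ) + b * Complex.I) ^ 2) (-(2 * Real.pi))
  have hint' : Integrable (𝓕 h) := by
    have := (integrable_cexp_div_sq hb 0 0).comp_mul_left' (R := -(2 * Real.pi))
      (by simp [Real.pi_ne_zero])
    refine this.neg.congr (ae_of_all _ fun ξ => ?_)
    rw [hF]
    simp
  have hinv := congrFun (hcont.fourierInv_fourier_eq hint hint') x
  rw [Real.fourierInv_eq'] at hinv
  have e : ∀ ξ : ℝ, Complex.exp (((2 * Real.pi * inner ℝ ξ x : ℝ) : ℂ) * Complex.I) • 𝓕 h ξ =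
      -(Complex.exp (-Complex.I * x * ((-(2 * Real.pi) * ξ : ℝ) : ℂ)) /
        (((-(2 * Real.pi) * ξ : ℝ) : ℂ) + b * Complex.I) ^ 2) := fun ξ => by
    rw [hF, smul_eq_mul, mul_neg, mul_one_div]
    congr 3
    simp
    ring
  simp_rw [e] at hinv
  rw [integral_neg, hsc, abs_inv, abs_neg, abs_of_pos (by positivity), Complex.real_smul] at hinv
  have hpi : (Real.pi : ℂ) ≠ 0 := by exact_mod_cast Real.pi_ne_zero
  push_cast at hinv
  have : ((max x 0 : ℝ) : ℂ) * Complex.exp (-b * x) = h x := rfl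
  rw [this, ← hinv]
  field_simp

/-- One integration by parts turns the conditionally convergent integral of a simple pole into an
absolutely convergent one. -/
theorem integral_cexp_div_by_parts {b x : ℝ} (hb : 0 < b) (hx : x ≠ 0) (c A A' : ℝ) :
    ∫ t in (-A)..A', Complex.exp (-Complex.I * x * t) / ((t : ℂ) + b * Complex.I - c) =
      1 / ((A' : ℂ) + b * Complex.I - c) * (Complex.I / x * Complex.exp (-Complex.I * x * A')) -
      1 / (((-A : ℝ) : ℂ) + b * Complex.I - c) *
        (Complex.I / x * Complex.exp (-Complex.I * x * (-A : ℝ))) +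
      Complex.I / x *
        ∫ t in (-A)..A', Complex.exp (-Complex.I * x * t) / ((t : ℂ) + b * Complex.I - c) ^ 2 := by
  have hxc : (x : ℂ) ≠ 0 := by exact_mod_cast hx
  have h1 : ∀ t : ℝ, HasDerivAt (fun y : ℝ => (y : ℂ)) 1 t := fun t => Complex.ofRealCLM.hasDerivAt
  have hu : ∀ t ∈ uIcc (-A) A', HasDerivAt (fun t : ℝ => 1 / ((t : ℂ) + b * Complex.I - c))
      (-1 / ((t : ℂ) + b * Complex.I - c) ^ 2) t := fun t _ => by
    have := (((h1 t).add_const (b * Complex.I)).sub_const (c : ℂ)).fun_inv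
      (add_mul_I_sub_ne_zero hb c t)
    simpa only [one_div] using this
  have hv : ∀ t ∈ uIcc (-A) A', HasDerivAt
      (fun t : ℝ => Complex.I / x * Complex.exp (-Complex.I * x * t))
      (Complex.exp (-Complex.I * x * t)) t := fun t _ => by
    have := (((h1 t).const_mul (-Complex.I * x)).cexp).const_mul (Complex.I / x)
    refine this.congr_deriv ?_
    field_simp
    linear_combination -Complex.I_sq
  have := intervalIntegral.integral_mul_deriv_eq_deriv_mul hu hv
    (Continuous.intervalIntegrable (Continuous.div (by fun_prop) (by fun_prop)
      fun t => pow_ne_zero 2 (add_mul_I_sub_ne_zero hb c t)) _ _)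
    (Continuous.intervalIntegrable (by fun_prop) _ _)
  rw [← intervalIntegral.integral_const_mul]
  simp_rw [div_eq_mul_inv (Complex.exp _), mul_comm (Complex.exp _), ← one_div]
  rw [this, sub_eq_add_neg (_ - _), ← intervalIntegral.integral_neg]
  congr 2
  ext t
  ring

/-! ### Convergence of the improper integral -/

theorem norm_I_div_ofReal (x : ℝ) : ‖Complex.I / (x : ℂ)‖ = 1 / |x| := by
  rw [norm_div, Complex.norm_I, Complex.norm_real, Real.norm_eq_abs]

theorem norm_integral_cexp_div_le {b x : ℝ} (hb : 0 < b) (hx : x ≠ 0) (c A A' : ℝ) :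
    ‖∫ t in (-A)..A', Complex.exp (-Complex.I * x * t) / ((t : ℂ) + b * Complex.I - c)‖ ≤
      1 / |x| * (2 / b + ∫ t : ℝ, (t ^ 2 + b ^ 2)⁻¹) := by
  have hbd : ∀ T : ℝ, ‖1 / ((T : ℂ) + b * Complex.I - c) *
      (Complex.I / x * Complex.exp (-Complex.I * x * T))‖ ≤ 1 / |x| * (1 / b) := fun T => by
    rw [norm_mul, norm_mul, norm_cexp_neg_I_mul, mul_one, norm_I_div_ofReal, norm_div, norm_one,
      mul_comm]
    gcongr
    exact le_norm_add_mul_I_sub b c T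
  have hint : ‖∫ t in (-A)..A',
      Complex.exp (-Complex.I * x * t) / ((t : ℂ) + b * Complex.I - c) ^ 2‖ ≤
        ∫ t : ℝ, (t ^ 2 + b ^ 2)⁻¹ := by
    refine intervalIntegral.norm_integral_le_integral_norm_uIoc.trans ?_
    refine (setIntegral_le_integral (integrable_cexp_div_sq hb c x).norm
      (ae_of_all _ fun t => norm_nonneg _)).trans ?_
    simp_rw [norm_cexp_div_sq]
    rw [integral_sub_right_eq_self (fun t : ℝ => (t ^ 2 + b ^ 2)⁻¹) c]
  rw [integral_cexp_div_by_parts hb hx]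
  refine (norm_add_le _ _).trans ?_
  refine (add_le_add ((norm_sub_le _ _).trans (add_le_add (hbd A') (hbd (-A)))) ?_).trans
    (b := 1 / |x| * (1 / b) + 1 / |x| * (1 / b) + 1 / |x| * ∫ t : ℝ, (t ^ 2 + b ^ 2)⁻¹) ?_
  · rw [norm_mul, norm_I_div_ofReal]
    gcongr
  · apply le_of_eq; ring

/-- The integral of `e^{-ixw} / (w - c)` along the line `Im w = b`: the residue at the real point
`c` below the line contributes for `x > 0` only. -/
theorem tendsto_integral_cexp_div {b x : ℝ} (hb : 0 < b) (hx : x ≠ 0) (c : ℝ) :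
    Tendsto (fun p : ℝ × ℝ => ∫ t in (-p.1)..p.2,
      Complex.exp (-Complex.I * x * (t + b * Complex.I)) / ((t : ℂ) + b * Complex.I - c))
      (atTop ×ˢ atTop)
      (𝓝 (if 0 < x then -(2 * Real.pi * Complex.I) * Complex.exp (-Complex.I * x * c) else 0)) := by
  have hfac : ∀ t : ℝ, Complex.exp (-Complex.I * x * (t + b * Complex.I)) /
      ((t : ℂ) + b * Complex.I - c) = Complex.exp (b * x) *
        (Complex.exp (-Complex.I * x * t) / ((t : ℂ) + b * Complex.I - c)) := fun t => by
    rw [← mul_div_assoc, ← Complex.exp_add]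
    congr 2
    linear_combination -(b * x : ℂ) * Complex.I_sq
  simp_rw [hfac, intervalIntegral.integral_const_mul, integral_cexp_div_by_parts hb hx]
  have hbot : Tendsto (fun p : ℝ × ℝ => -p.1) (atTop ×ˢ atTop) atBot :=
    tendsto_neg_atTop_atBot.comp tendsto_fst
  have hbdry : ∀ l : Filter ℝ, Tendsto (fun t : ℝ => |t - c|) l atTop → Tendsto (fun t : ℝ =>
      1 / ((t : ℂ) + b * Complex.I - c) * (Complex.I / x * Complex.exp (-Complex.I * x * t))) l
      (𝓝 0) := fun l hl => by
    refine squeeze_zero_norm' (a := fun t => |t - c|⁻¹ * (1 / |x|)) ?_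
      (by simpa using (tendsto_inv_atTop_zero.comp hl).mul_const (1 / |x|))
    filter_upwards [hl.eventually_gt_atTop 0] with t ht
    rw [norm_mul, norm_mul, norm_cexp_neg_I_mul, mul_one, norm_I_div_ofReal, norm_div, norm_one,
      one_div ‖_‖]
    gcongr
    exact abs_sub_le_norm_add_mul_I_sub b c t
  have htop' : Tendsto (fun t : ℝ => |t - c|) atTop atTop :=
    tendsto_abs_atTop_atTop.comp (tendsto_atTop_add_const_right _ (-c) tendsto_id)
  have hbot' : Tendsto (fun t : ℝ => |t - c|) atBot atTop :=
    tendsto_abs_atBot_atTop.comp (tendsto_atBot_add_const_right _ (-c) tendsto_id)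
  have h1 := (hbdry _ htop').comp (tendsto_snd (f := (atTop : Filter ℝ)) (g := (atTop : Filter ℝ)))
  have h2 := (hbdry _ hbot').comp hbot
  have h3 := intervalIntegral_tendsto_integral (integrable_cexp_div_sq hb c x) hbot
    (tendsto_snd (f := (atTop : Filter ℝ)) (g := (atTop : Filter ℝ)))
  have hval : ∫ t : ℝ, Complex.exp (-Complex.I * x * t) / ((t : ℂ) + b * Complex.I - c) ^ 2 =
      Complex.exp (-Complex.I * x * c) *
        (-(2 * Real.pi) * ((max x 0 : ℝ) * Complex.exp (-b * x))) := by
    rw [← integral_cexp_div_sq hb, ← integral_const_mul, ← integral_add_right_eq_self _ c]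
    congr 1
    ext t
    rw [← mul_div_assoc, ← Complex.exp_add]
    congr 2
    · push_cast; ring
    · push_cast; ring
  have h4 := ((h1.sub h2).add (h3.const_mul (Complex.I / x))).const_mul (Complex.exp (b * x))
  refine (h4.congr fun p => rfl).trans (le_of_eq ?_)
  congr 1
  rw [hval]
  have hxc : (x : ℂ) ≠ 0 := by exact_mod_cast hx
  have hee : Complex.exp (b * x) * Complex.exp (-b * x) = 1 := by
    rw [← Complex.exp_add]; simp
  split_ifs with h
  · rw [max_eq_left h.le]
    have hcancel : Complex.I / x * (Complex.exp (-Complex.I * x * c) *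
        (-(2 * Real.pi) * (x * Complex.exp (-b * x)))) =
        -(2 * Real.pi * Complex.I) * Complex.exp (-Complex.I * x * c) * Complex.exp (-b * x) := by
      rw [div_mul_eq_mul_div, div_eq_iff hxc]
      ring
    rw [hcancel]
    linear_combination -(2 * Real.pi * Complex.I) * Complex.exp (-Complex.I * x * c) * hee
  · rw [max_eq_right (not_lt.1 h)]; simp

/-- The band-limited function `∫ ρ(v) e^{-ixu(v)} dv`, with `ρ` the density `cutDensity` and `u`
the point `cutPoint`; for `x > 0` it is a multiple of `q_s`. -/
noncomputable def cutTransform (τ x : ℝ) : ℂ :=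
  ∫ v, cutDensity τ v * Complex.exp (-Complex.I * x * cutPoint v)

/-- The constant in `q_s = spectralFactor · cutTransform`. -/
noncomputable def spectralFactor (s : ℝ) : ℂ :=
  ((1 / Real.sqrt (2 * Real.pi) : ℝ) : ℂ) * (cutFactor (spectralExponent s) *
    -(2 * Real.pi * Complex.I))

theorem spectralFactor_ne_zero (s : ℝ) : spectralFactor s ≠ 0 := by
  have h1 : (1 / Real.sqrt (2 * Real.pi) : ℝ) ≠ 0 := by positivity
  have h2 : (Real.pi : ℂ) ≠ 0 := by exact_mod_cast Real.pi_ne_zero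
  refine mul_ne_zero (by exact_mod_cast h1) (mul_ne_zero (cutFactor_ne_zero _) ?_)
  simp [h2]

theorem qTrunc_eq {b : ℝ} (hb : 0 < b) (s x A A' : ℝ) :
    qTrunc b s x A A' = ((1 / Real.sqrt (2 * Real.pi) : ℝ) : ℂ) *
      (cutFactor (spectralExponent s) * ∫ v, cutDensity (spectralExponent s) v *
        ∫ t in (-A)..A', Complex.exp (-Complex.I * x * (t + b * Complex.I)) /
          ((t : ℂ) + b * Complex.I - cutPoint v)) := by
  set τ := spectralExponent s
  rw [qTrunc]
  congr 1
  have hne : ∀ p : ℝ × ℝ, (p.1 : ℂ) + b * Complex.I - cutPoint p.2 ≠ 0 :=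
    fun p => add_mul_I_sub_ne_zero hb _ _
  have hint : Integrable (Function.uncurry fun t v : ℝ =>
      Complex.exp (-Complex.I * x * (t + b * Complex.I)) *
        (cutDensity τ v / ((t : ℂ) + b * Complex.I - cutPoint v)))
      ((volume.restrict (uIoc (-A) A')).prod volume) := by
    have hdom : Integrable (fun p : ℝ × ℝ => (Real.exp (x * b) * b⁻¹) * ‖cutDensity τ p.2‖)
        ((volume.restrict (uIoc (-A) A')).prod volume) :=
      Integrable.mul_prod (f := fun _ : ℝ => Real.exp (x * b) * b⁻¹)
        (integrable_const_iff.2 (Or.inr (by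
          rw [isFiniteMeasure_restrict, uIoc]; exact measure_Ioc_lt_top.ne)))
        (integrable_cutDensity τ).norm
    refine hdom.mono' ?_ (ae_of_all _ fun p => ?_)
    · refine Continuous.aestronglyMeasurable ?_
      refine Continuous.mul (by fun_prop) (Continuous.div ?_ ?_ hne)
      · exact (continuous_cutDensity τ).comp continuous_snd
      · have := continuous_cutPoint
        fun_prop
    · have h1 : ‖Complex.exp (-Complex.I * x * (p.1 + b * Complex.I))‖ = Real.exp (x * b) := by
        rw [Complex.norm_exp]; simp
      simp only [Function.uncurry]
      rw [norm_mul, h1, norm_div, div_eq_mul_inv, mul_comm ‖cutDensity τ p.2‖, mul_assoc]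
      gcongr
      exact le_norm_add_mul_I_sub b _ _
  have hQ : ∀ t : ℝ, Q s (t + b * Complex.I) = cutFactor τ *
      ∫ v, cutDensity τ v / (t + b * Complex.I - cutPoint v) := fun t =>
    Q_eq_cauchy_integral s (by simpa using hb)
  simp_rw [hQ, mul_left_comm _ (cutFactor τ)]
  rw [intervalIntegral.integral_const_mul]
  congr 1
  simp_rw [← integral_const_mul]
  rw [intervalIntegral_integral_swap hint]
  congr 1
  ext v
  rw [← intervalIntegral.integral_const_mul]
  congr 1
  ext t
  ring

theorem tendsto_qTrunc {b : ℝ} (hb : 0 < b) (s : ℝ) {x : ℝ} (hx : x ≠ 0) :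
    Tendsto (fun p : ℝ × ℝ => qTrunc b s x p.1 p.2) (atTop ×ˢ atTop)
      (𝓝 (if 0 < x then spectralFactor s * cutTransform (spectralExponent s) x else 0)) := by
  set τ := spectralExponent s with hτ
  have hlim : Tendsto (fun p : ℝ × ℝ => ∫ v, cutDensity τ v *
        ∫ t in (-p.1)..p.2, Complex.exp (-Complex.I * x * (t + b * Complex.I)) /
          ((t : ℂ) + b * Complex.I - cutPoint v)) (atTop ×ˢ atTop)
      (𝓝 (∫ v, cutDensity τ v * if 0 < x then
        -(2 * Real.pi * Complex.I) * Complex.exp (-Complex.I * x * cutPoint v) else 0)) := by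
    refine tendsto_integral_filter_of_dominated_convergence
      (fun v => ‖cutDensity τ v‖ *
        (Real.exp (b * x) * (1 / |x| * (2 / b + ∫ t : ℝ, (t ^ 2 + b ^ 2)⁻¹)))) ?_ ?_
      ((integrable_cutDensity τ).norm.mul_const _) ?_
    · refine Eventually.of_forall fun p => Continuous.aestronglyMeasurable ?_
      refine (continuous_cutDensity τ).mul ?_
      have hc := continuous_cutPoint
      refine intervalIntegral.continuous_parametric_intervalIntegral_of_continuous' ?_ _ _
      exact Continuous.div (by fun_prop) (by fun_prop) fun p => add_mul_I_sub_ne_zero hb _ _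
    · refine Eventually.of_forall fun p => ae_of_all _ fun v => ?_
      rw [norm_mul]
      gcongr
      have hfac : ∀ t : ℝ, Complex.exp (-Complex.I * x * (t + b * Complex.I)) /
          ((t : ℂ) + b * Complex.I - cutPoint v) = Complex.exp (b * x) *
            (Complex.exp (-Complex.I * x * t) / ((t : ℂ) + b * Complex.I - cutPoint v)) := fun t => by
        rw [← mul_div_assoc, ← Complex.exp_add]
        congr 2
        linear_combination -(b * x : ℂ) * Complex.I_sq
      simp_rw [hfac, intervalIntegral.integral_const_mul]
      rw [norm_mul, Complex.norm_exp, show ((b : ℂ) * x).re = b * x by simp]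
      gcongr
      exact norm_integral_cexp_div_le hb hx _ _ _
    · exact ae_of_all _ fun v => (tendsto_integral_cexp_div hb hx _).const_mul _
  simp_rw [qTrunc_eq hb]
  refine ((hlim.const_mul _).const_mul _).trans (le_of_eq ?_)
  congr 1
  split_ifs with h
  · simp_rw [mul_left_comm (cutDensity τ _)]
    rw [integral_const_mul, spectralFactor, cutTransform]
    ring
  · simp

theorem qPlus_eq {b : ℝ} (hb : 0 < b) (s : ℝ) {x : ℝ} (hx : x ≠ 0) :
    qPlus b s x = if 0 < x then spectralFactor s * cutTransform (spectralExponent s) x else 0 :=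
  (tendsto_qTrunc hb s hx).limUnder_eq

/-! ### Decay of the spectral function -/

theorem norm_cexp_cutPoint (x v : ℝ) : ‖Complex.exp (-Complex.I * x * cutPoint v)‖ = 1 :=
  norm_cexp_neg_I_mul x _

theorem integrable_cutDensity_mul_cexp (τ x : ℝ) :
    Integrable fun v => cutDensity τ v * Complex.exp (-Complex.I * x * cutPoint v) := by
  have := continuous_cutPoint
  refine (integrable_cutDensity τ).mul_bdd (c := 1) (by fun_prop)
    (ae_of_all _ fun v => (norm_cexp_cutPoint x v).le)

theorem continuous_cutTransform (τ : ℝ) : Continuous (cutTransform τ) := by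
  refine continuous_of_dominated (bound := fun v => ‖cutDensity τ v‖)
    (fun x => (integrable_cutDensity_mul_cexp τ x).aestronglyMeasurable)
    (fun x => ae_of_all _ fun v => ?_) (integrable_cutDensity τ).norm
    (ae_of_all _ fun v => by fun_prop)
  rw [norm_mul, norm_cexp_cutPoint, mul_one]

theorem norm_cutTransform_le (τ x : ℝ) : ‖cutTransform τ x‖ ≤ ∫ v, ‖cutDensity τ v‖ := by
  refine (norm_integral_le_integral_norm _).trans (le_of_eq ?_)
  simp_rw [norm_mul, norm_cexp_cutPoint, mul_one]

theorem cutTransform_zero_ne_zero (τ : ℝ) : cutTransform τ 0 ≠ 0 := fun h => by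
  have := cutFactor_mul_integral_cutDensity τ
  rw [cutTransform] at h
  simp only [Complex.ofReal_zero, mul_zero, zero_mul, Complex.exp_zero, mul_one] at h
  rw [h, mul_zero] at this
  exact zero_ne_one this

theorem hasDerivAt_cutPoint (v : ℝ) :
    HasDerivAt cutPoint (-(2 * Real.exp v) / (1 + Real.exp v) ^ 2) v := by
  have h := ((Real.hasDerivAt_exp v).const_sub 1).fun_div ((Real.hasDerivAt_exp v).const_add 1)
    (by positivity)
  refine h.congr_deriv ?_
  congr 1
  ring

/-- The quotient of `cutDensity` by the derivative of the phase `cutPoint`, multiplied by `-2`. -/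
noncomputable def phaseAmplitude (τ v : ℝ) : ℂ :=
  Complex.exp ((-(1 / 2) + τ * Complex.I) * v) + Complex.exp ((1 / 2 + τ * Complex.I) * v)

theorem norm_cexp_half (τ v : ℝ) :
    ‖Complex.exp ((1 / 2 + τ * Complex.I) * v)‖ = Real.exp (1 / 2 * v) := by
  rw [Complex.norm_exp]; simp

theorem norm_cexp_neg_half (τ v : ℝ) :
    ‖Complex.exp ((-(1 / 2) + τ * Complex.I) * v)‖ = Real.exp (-(1 / 2) * v) := by
  rw [Complex.norm_exp]; simp

theorem hasDerivAt_phaseAmplitude (τ v : ℝ) : HasDerivAt (phaseAmplitude τ)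
    ((-(1 / 2) + τ * Complex.I) * Complex.exp ((-(1 / 2) + τ * Complex.I) * v) +
      (1 / 2 + τ * Complex.I) * Complex.exp ((1 / 2 + τ * Complex.I) * v)) v := by
  have h1 : HasDerivAt (fun y : ℝ => (y : ℂ)) 1 v := Complex.ofRealCLM.hasDerivAt
  have h := ((h1.const_mul (-(1 / 2) + τ * Complex.I)).cexp).fun_add
    ((h1.const_mul (1 / 2 + τ * Complex.I)).cexp)
  refine h.congr_deriv ?_
  ring

theorem hasDerivAt_cexp_cutPoint {x : ℝ} (hx : x ≠ 0) (v : ℝ) :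
    HasDerivAt (fun v => -Complex.I / (2 * x) * Complex.exp (-Complex.I * x * cutPoint v))
      ((Real.exp v / (1 + Real.exp v) ^ 2 : ℝ) * Complex.exp (-Complex.I * x * cutPoint v)) v := by
  have hxc : (x : ℂ) ≠ 0 := by exact_mod_cast hx
  have h := (((hasDerivAt_cutPoint v).ofReal_comp.const_mul (-Complex.I * x)).cexp).const_mul
    (-Complex.I / (2 * x))
  refine h.congr_deriv ?_
  have h0 : (1 + Complex.exp v) ≠ 0 := by
    rw [← Complex.ofReal_exp]; exact_mod_cast (by positivity : (1 + Real.exp v) ≠ 0)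
  push_cast
  field_simp
  linear_combination -Complex.I_sq

theorem cutDensity_eq_phaseAmplitude_mul (τ v : ℝ) :
    cutDensity τ v = phaseAmplitude τ v * (Real.exp v / (1 + Real.exp v) ^ 2 : ℝ) := by
  have h0 : (1 + Complex.exp v) ≠ 0 := by
    rw [← Complex.ofReal_exp]; exact_mod_cast (by positivity : (1 + Real.exp v) ≠ 0)
  have h1 : Complex.exp ((1 / 2 + τ * Complex.I) * v) =
      Complex.exp ((-(1 / 2) + τ * Complex.I) * v) * Complex.exp v := by
    rw [← Complex.exp_add]; congr 1; ring
  rw [cutDensity, phaseAmplitude, h1]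
  push_cast
  field_simp

theorem norm_integral_middle_le (τ : ℝ) {x M : ℝ} (hx : 0 < x) (hM : 0 ≤ M) :
    ‖∫ v in (-M)..M, cutDensity τ v * Complex.exp (-Complex.I * x * cutPoint v)‖ ≤
      2 * (3 / 2 + |τ|) * Real.exp (1 / 2 * M) / x := by
  set K := 1 / 2 + |τ| with hK
  have hcp := continuous_cutPoint
  have hMM : -M ≤ M := by linarith
  have hparts := intervalIntegral.integral_mul_deriv_eq_deriv_mul (a := -M) (b := M)
    (fun v _ => hasDerivAt_phaseAmplitude τ v) (fun v _ => hasDerivAt_cexp_cutPoint hx.ne' v)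
    (Continuous.intervalIntegrable (by fun_prop) _ _)
    (Continuous.intervalIntegrable (by
      refine Continuous.mul (Complex.continuous_ofReal.comp ?_) (by fun_prop)
      exact Continuous.div (by fun_prop) (by fun_prop) fun v => by positivity) _ _)
  have hK1 : ‖(1 / 2 + τ * Complex.I : ℂ)‖ ≤ K := by
    refine (norm_add_le _ _).trans ?_
    simp [hK]
  have hK2 : ‖(-(1 / 2) + τ * Complex.I : ℂ)‖ ≤ K := by
    refine (norm_add_le _ _).trans ?_
    simp [hK]
  have hE : ∀ v, ‖-Complex.I / (2 * x) * Complex.exp (-Complex.I * x * cutPoint v)‖ = 1 / (2 * x) := by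
    intro v
    rw [norm_mul, norm_cexp_cutPoint, mul_one, norm_div, norm_neg, Complex.norm_I, norm_mul,
      Complex.norm_real, Real.norm_of_nonneg hx.le]
    simp
  have hb : ∀ v, |v| ≤ M → ‖phaseAmplitude τ v‖ ≤ 2 * Real.exp (1 / 2 * M) := fun v hv => by
    refine (norm_add_le _ _).trans ?_
    rw [norm_cexp_half, norm_cexp_neg_half, two_mul]
    have := abs_le.1 hv
    exact add_le_add (Real.exp_le_exp.2 (by linarith)) (Real.exp_le_exp.2 (by linarith))
  have hint : ‖∫ v in (-M)..M, ((-(1 / 2) + τ * Complex.I) *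
        Complex.exp ((-(1 / 2) + τ * Complex.I) * v) +
      (1 / 2 + τ * Complex.I) * Complex.exp ((1 / 2 + τ * Complex.I) * v)) *
      (-Complex.I / (2 * x) * Complex.exp (-Complex.I * x * cutPoint v))‖ ≤
      4 * K * Real.exp (1 / 2 * M) * (1 / (2 * x)) := by
    have hle : ∀ v : ℝ, ‖((-(1 / 2) + τ * Complex.I) *
        Complex.exp ((-(1 / 2) + τ * Complex.I) * v) +
      (1 / 2 + τ * Complex.I) * Complex.exp ((1 / 2 + τ * Complex.I) * v)) *
      (-Complex.I / (2 * x) * Complex.exp (-Complex.I * x * cutPoint v))‖ ≤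
      K * (Real.exp (-(1 / 2) * v) + Real.exp (1 / 2 * v)) * (1 / (2 * x)) := fun v => by
      rw [norm_mul, hE]
      gcongr
      refine (norm_add_le _ _).trans ?_
      rw [norm_mul, norm_mul, norm_cexp_half, norm_cexp_neg_half, mul_add]
      gcongr
    refine (intervalIntegral.norm_integral_le_of_norm_le hMM (ae_of_all _ fun v _ => hle v)
      (Continuous.intervalIntegrable (by fun_prop) _ _)).trans ?_
    rw [intervalIntegral.integral_mul_const, intervalIntegral.integral_const_mul]
    have hval : ∫ v in (-M)..M, (Real.exp (-(1 / 2) * v) + Real.exp (1 / 2 * v)) =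
        4 * (Real.exp (1 / 2 * M) - Real.exp (-(1 / 2) * M)) := by
      rw [intervalIntegral.integral_eq_sub_of_hasDerivAt
        (f := fun v => 2 * (Real.exp (1 / 2 * v) - Real.exp (-(1 / 2) * v)))
        (fun v _ => ?_) (Continuous.intervalIntegrable (by fun_prop) _ _)]
      · rw [show 1 / 2 * -M = -(1 / 2) * M by ring, show -(1 / 2) * -M = 1 / 2 * M by ring]; ring
      · have h := ((((hasDerivAt_id' v).const_mul (1 / 2)).exp).fun_sub
          (((hasDerivAt_id' v).const_mul (-(1 / 2))).exp)).const_mul 2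
        refine h.congr_deriv ?_
        ring
    rw [hval]
    have hK0 : 0 ≤ K := by positivity
    have : K * (4 * (Real.exp (1 / 2 * M) - Real.exp (-(1 / 2) * M))) ≤
        4 * K * Real.exp (1 / 2 * M) := by
      nlinarith [mul_nonneg hK0 (Real.exp_pos (-(1 / 2) * M)).le]
    gcongr
  have hbdry : ∀ v, |v| ≤ M → ‖phaseAmplitude τ v *
      (-Complex.I / (2 * x) * Complex.exp (-Complex.I * x * cutPoint v))‖ ≤
        2 * Real.exp (1 / 2 * M) * (1 / (2 * x)) := fun v hv => by
    rw [norm_mul, hE]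
    gcongr
    exact hb v hv
  have heq : ∀ v, cutDensity τ v * Complex.exp (-Complex.I * x * cutPoint v) =
      phaseAmplitude τ v * ((Real.exp v / (1 + Real.exp v) ^ 2 : ℝ) *
        Complex.exp (-Complex.I * x * cutPoint v)) := fun v => by
    rw [cutDensity_eq_phaseAmplitude_mul, mul_assoc]
  simp_rw [heq]
  rw [hparts]
  refine (norm_sub_le _ _).trans ((add_le_add ((norm_sub_le _ _).trans (add_le_add
    (hbdry M (by rw [abs_of_nonneg hM])) (hbdry (-M) (by rw [abs_neg, abs_of_nonneg hM]))))
    hint).trans (le_of_eq ?_))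
  rw [hK]
  field_simp
  ring

/-- The tails `|v| ≥ log x` are estimated in absolute value, and the middle part, where the phase
has no critical point, by an integration by parts. -/
theorem exists_norm_cutTransform_le (τ : ℝ) :
    ∃ C, ∀ x : ℝ, 1 ≤ x → ‖cutTransform τ x‖ ≤ C * x ^ (-(1 / 2) : ℝ) := by
  refine ⟨2 * (3 / 2 + |τ|) + 4, fun x hx => ?_⟩
  have hx0 : 0 < x := by linarith
  -- this `M` balances the tails, of size `e^{-M/2}`, against the middle part, `e^{M/2} / x`
  set M := Real.log x with hM
  have hM0 : 0 ≤ M := Real.log_nonneg hx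
  have hint := integrable_cutDensity_mul_cexp τ x
  have hsplit : cutTransform τ x =
      (∫ v in Iic (-M), cutDensity τ v * Complex.exp (-Complex.I * x * cutPoint v)) +
      (∫ v in (-M)..M, cutDensity τ v * Complex.exp (-Complex.I * x * cutPoint v)) +
      ∫ v in Ioi M, cutDensity τ v * Complex.exp (-Complex.I * x * cutPoint v) := by
    rw [cutTransform, ← intervalIntegral.integral_Iic_add_Ioi hint.integrableOn hint.integrableOn
      (b := M), ← intervalIntegral.integral_Iic_sub_Iic hint.integrableOn hint.integrableOn]
    ring
  have hle : ∀ v, ‖cutDensity τ v * Complex.exp (-Complex.I * x * cutPoint v)‖ ≤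
      Real.exp (-(1 / 2) * |v|) := fun v => by
    rw [norm_mul, norm_cexp_cutPoint, mul_one, norm_cutDensity]
    exact exp_half_div_le_exp_neg_abs v
  have hright : ‖∫ v in Ioi M, cutDensity τ v * Complex.exp (-Complex.I * x * cutPoint v)‖ ≤
      2 * Real.exp (-(1 / 2) * M) := by
    refine (norm_integral_le_of_norm_le integrable_exp_neg_abs.integrableOn
      (ae_of_all _ hle)).trans (le_of_eq ?_)
    rw [setIntegral_congr_fun (g := fun v => Real.exp (-(1 / 2) * v)) measurableSet_Ioi
      fun v hv => by simp only [abs_of_nonneg (hM0.trans (le_of_lt hv))],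
      integral_exp_mul_Ioi (by norm_num)]
    ring
  have hleft : ‖∫ v in Iic (-M), cutDensity τ v * Complex.exp (-Complex.I * x * cutPoint v)‖ ≤
      2 * Real.exp (-(1 / 2) * M) := by
    refine (norm_integral_le_of_norm_le integrable_exp_neg_abs.integrableOn
      (ae_of_all _ hle)).trans (le_of_eq ?_)
    rw [setIntegral_congr_fun (g := fun v => Real.exp (1 / 2 * v)) measurableSet_Iic
      fun v hv => by
        have : v ≤ 0 := (mem_Iic.1 hv).trans (by linarith)
        simp only [abs_of_nonpos this]
        congr 1; ring,
      integral_exp_mul_Iic (by norm_num), show 1 / 2 * -M = -(1 / 2) * M by ring]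
    ring
  have he1 : Real.exp (-(1 / 2) * M) = x ^ (-(1 / 2) : ℝ) := by
    rw [Real.rpow_def_of_pos hx0, mul_comm]
  have he2 : Real.exp (1 / 2 * M) / x = x ^ (-(1 / 2) : ℝ) := by
    rw [← he1, div_eq_iff hx0.ne']
    calc Real.exp (1 / 2 * M) = Real.exp (-(1 / 2) * M) * Real.exp M := by
          rw [← Real.exp_add]; congr 1; ring
      _ = _ := by rw [hM, Real.exp_log hx0]
  have hmid := norm_integral_middle_le τ hx0 hM0
  rw [mul_div_assoc, he2] at hmid
  rw [he1] at hleft hright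
  rw [hsplit]
  refine (norm_add_le _ _).trans ?_
  refine (add_le_add (norm_add_le _ _) le_rfl).trans ?_
  linarith

theorem abs_sinc_le_inv {x : ℝ} (hx : x ≠ 0) : |Real.sinc x| ≤ 1 / |x| := by
  rw [Real.sinc_of_ne_zero hx, abs_div]
  gcongr
  exact Real.abs_sin_le_one x

theorem integrableOn_sincKernel_mul_cutTransform (τ : ℝ) {x : ℝ} (hx : 0 < x) :
    IntegrableOn (fun y => (sincKernel (x - y) : ℂ) * cutTransform τ y) (Ioi 0) := by
  obtain ⟨C, hC⟩ := exists_norm_cutTransform_le τ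
  have hcF := continuous_cutTransform τ
  have hcont : Continuous fun y => (sincKernel (x - y) : ℂ) * cutTransform τ y := by
    unfold sincKernel
    have := Real.continuous_sinc
    fun_prop
  -- beyond `N` one has `y - x ≥ y / 2`, so the product is `O(y ^ (-3/2))`
  set N := max 1 (2 * x) with hN
  have hN1 : 1 ≤ N := le_max_left _ _
  have hN2 : 2 * x ≤ N := le_max_right _ _
  rw [← Ioc_union_Ioi_eq_Ioi (zero_le_one.trans hN1)]
  refine IntegrableOn.union ?_ ?_
  · exact (hcont.integrableOn_Icc (a := 0) (b := N)).mono_set Ioc_subset_Icc_self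
  · refine Integrable.mono' ((integrableOn_Ioi_rpow_of_lt (a := -(3 / 2)) (by norm_num)
      (zero_lt_one.trans_le hN1)).const_mul (2 * C)) hcont.aestronglyMeasurable
      ((ae_restrict_iff' measurableSet_Ioi).2 (ae_of_all _ fun y hy => ?_))
    have hy' : N < y := hy
    have hy0 : 0 < y := by linarith
    have hk : |sincKernel (x - y)| ≤ 2 / y := by
      have h1 : |x - y| = y - x := by rw [abs_sub_comm, abs_of_pos]; linarith
      have h2 := abs_sinc_le_inv (x := x - y) (by linarith)
      rw [sincKernel, abs_mul, abs_of_pos (by positivity)]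
      have h3 : 1 / Real.pi ≤ 1 := by
        rw [div_le_one Real.pi_pos]; linarith [Real.pi_gt_three]
      calc 1 / Real.pi * |Real.sinc (x - y)| ≤ 1 * (1 / |x - y|) := by gcongr
        _ ≤ 2 / y := by
          rw [h1, one_mul, div_le_div_iff₀ (by linarith) hy0]; linarith
    have h32 : y ^ (-(3 / 2) : ℝ) = y⁻¹ * y ^ (-(1 / 2) : ℝ) := by
      rw [← Real.rpow_neg_one, ← Real.rpow_add hy0]; norm_num
    rw [norm_mul, Complex.norm_real, Real.norm_eq_abs, h32]
    calc _ ≤ 2 / y * (C * y ^ (-(1 / 2) : ℝ)) := by gcongr; exact hC y (by linarith)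
      _ = _ := by ring

/-! ### Half-line integrals with an exponential factor -/

/-- The kernel is the inverse Fourier transform of the indicator function of `[-1, 1]`. -/
theorem sincKernel_eq_integral (y : ℝ) :
    (sincKernel y : ℂ) = 1 / (2 * Real.pi) * ∫ r in (-1 : ℝ)..1, Complex.exp (-Complex.I * y * r) := by
  have hpi : (Real.pi : ℂ) ≠ 0 := by exact_mod_cast Real.pi_ne_zero
  rw [sincKernel]
  rcases eq_or_ne y 0 with rfl | hy
  · simp
    field_simp
    norm_num
  · have hyc : (y : ℂ) ≠ 0 := by exact_mod_cast hy
    rw [integral_exp_mul_complex (by simp [hyc]), Real.sinc_of_ne_zero hy]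
    push_cast
    rw [Complex.sin]
    field_simp
    rw [Complex.I_sq]
    ring

theorem continuous_cexp_mul_cutTransform (τ ε : ℝ) :
    Continuous fun y : ℝ => Complex.exp (-ε * y) * cutTransform τ y := by
  have := continuous_cutTransform τ
  fun_prop

theorem norm_cexp_neg_mul (ε y : ℝ) : ‖Complex.exp (-ε * y)‖ = Real.exp (-ε * y) := by
  rw [Complex.norm_exp]; simp

theorem integrableOn_cexp_mul_cutTransform (τ : ℝ) {ε : ℝ} (hε : 0 < ε) :
    IntegrableOn (fun y : ℝ => Complex.exp (-ε * y) * cutTransform τ y) (Ioi 0) := by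
  refine Integrable.mono' ((integrableOn_exp_mul_Ioi (a := -ε) (by linarith) 0).mul_const
    (∫ v, ‖cutDensity τ v‖)) (continuous_cexp_mul_cutTransform τ ε).aestronglyMeasurable
    (ae_of_all _ fun y => ?_)
  rw [norm_mul, norm_cexp_neg_mul]
  gcongr
  exact norm_cutTransform_le τ y

/-- The half-line Fourier transform of `cutTransform`, at a point of the upper half-plane, is the
Cauchy transform of the density. -/
theorem integral_cexp_mul_cutTransform (τ : ℝ) {ε : ℝ} (hε : 0 < ε) (r : ℝ) :
    ∫ y in Ioi (0 : ℝ), Complex.exp (Complex.I * r * y) * (Complex.exp (-ε * y) * cutTransform τ y) =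
      Complex.I * ∫ v, cutDensity τ v / ((r : ℂ) + ε * Complex.I - cutPoint v) := by
  have hcp := continuous_cutPoint
  have hcd := continuous_cutDensity τ
  have hint : Integrable (Function.uncurry fun y v : ℝ => Complex.exp (Complex.I * r * y) *
      (Complex.exp (-ε * y) * (cutDensity τ v * Complex.exp (-Complex.I * y * cutPoint v))))
      ((volume.restrict (Ioi 0)).prod volume) := by
    have hdom : Integrable (fun p : ℝ × ℝ => Real.exp (-ε * p.1) * ‖cutDensity τ p.2‖)
        ((volume.restrict (Ioi 0)).prod volume) :=
      Integrable.mul_prod (integrableOn_exp_mul_Ioi (a := -ε) (by linarith) 0)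
        (integrable_cutDensity τ).norm
    refine hdom.mono' (Continuous.aestronglyMeasurable (by fun_prop)) (ae_of_all _ fun p => ?_)
    simp only [Function.uncurry]
    have h1 : ‖Complex.exp (Complex.I * r * p.1)‖ = 1 := by rw [Complex.norm_exp]; simp
    rw [norm_mul, norm_mul, norm_mul, h1, norm_cexp_neg_mul, norm_cexp_cutPoint, one_mul, mul_one]
  simp_rw [cutTransform, ← integral_const_mul]
  rw [integral_integral_swap hint]
  congr 1
  ext v
  have hc : ∀ y : ℝ, Complex.exp (Complex.I * r * y) *
      (Complex.exp (-ε * y) * (cutDensity τ v * Complex.exp (-Complex.I * y * cutPoint v))) =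
      cutDensity τ v * Complex.exp ((Complex.I * (r - cutPoint v) - ε) * y) := fun y => by
    rw [mul_left_comm _ (cutDensity τ v), mul_left_comm _ (cutDensity τ v), ← Complex.exp_add,
      ← Complex.exp_add]
    congr 2
    ring
  simp_rw [hc]
  rw [integral_const_mul, integral_exp_mul_complex_Ioi (by simpa using hε)]
  have hne := add_mul_I_sub_ne_zero hε (cutPoint v) r
  have hfac : Complex.I * (r - cutPoint v) - ε = Complex.I * (r + ε * Complex.I - cutPoint v) := by
    linear_combination -(ε : ℂ) * Complex.I_sq
  have hinv : -1 / (Complex.I * ((r : ℂ) + ε * Complex.I - cutPoint v)) =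
      Complex.I / (r + ε * Complex.I - cutPoint v) := by
    rw [div_eq_div_iff (mul_ne_zero Complex.I_ne_zero hne) hne]
    linear_combination -((r : ℂ) + ε * Complex.I - cutPoint v) * Complex.I_sq
  rw [hfac, Complex.ofReal_zero, mul_zero, Complex.exp_zero, hinv]
  ring

theorem integral_sincKernel_mul_cexp (τ : ℝ) {ε : ℝ} (hε : 0 < ε) (x : ℝ) :
    ∫ y in Ioi (0 : ℝ), (sincKernel (x - y) : ℂ) * (Complex.exp (-ε * y) * cutTransform τ y) =
      Complex.I / (2 * Real.pi) * ∫ r in (-1 : ℝ)..1, Complex.exp (-Complex.I * x * r) *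
        ∫ v, cutDensity τ v / ((r : ℂ) + ε * Complex.I - cutPoint v) := by
  have hcF := continuous_cexp_mul_cutTransform τ ε
  have hint : Integrable (Function.uncurry fun r y : ℝ => Complex.exp (-Complex.I * x * r) *
      (Complex.exp (Complex.I * r * y) * (Complex.exp (-ε * y) * cutTransform τ y)))
      ((volume.restrict (uIoc (-1) 1)).prod (volume.restrict (Ioi 0))) := by
    have hdom : Integrable (fun p : ℝ × ℝ => (1 : ℝ) * ‖Complex.exp (-ε * p.2) * cutTransform τ p.2‖)
        ((volume.restrict (uIoc (-1) 1)).prod (volume.restrict (Ioi 0))) :=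
      Integrable.mul_prod (f := fun _ : ℝ => (1 : ℝ))
        (integrable_const_iff.2 (Or.inr (by
          rw [isFiniteMeasure_restrict, uIoc]; exact measure_Ioc_lt_top.ne)))
        (integrableOn_cexp_mul_cutTransform τ hε).norm
    refine hdom.mono' (Continuous.aestronglyMeasurable ?_) (ae_of_all _ fun p => ?_)
    · simp only [Function.uncurry_def]
      have := hcF.comp (continuous_snd (X := ℝ) (Y := ℝ))
      simp only [Function.comp_def] at this
      exact Continuous.mul (by fun_prop) (Continuous.mul (by fun_prop) this)
    · simp only [Function.uncurry]
      have h1 : ‖Complex.exp (Complex.I * p.1 * p.2)‖ = 1 := by rw [Complex.norm_exp]; simp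
      rw [norm_mul, norm_cexp_neg_I_mul, norm_mul, h1, one_mul]
  have hswap := intervalIntegral_integral_swap hint
  simp_rw [integral_const_mul, integral_cexp_mul_cutTransform τ hε] at hswap
  simp_rw [mul_left_comm _ Complex.I] at hswap
  rw [intervalIntegral.integral_const_mul] at hswap
  rw [div_mul_eq_mul_div, hswap, ← integral_div]
  congr 1
  ext y
  rw [sincKernel_eq_integral, mul_assoc, one_div_mul_eq_div, ← intervalIntegral.integral_mul_const]
  congr 1
  congr 1
  ext r
  rw [← mul_assoc (Complex.exp (-Complex.I * x * r)) (Complex.exp (Complex.I * r * y)),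
    ← Complex.exp_add]
  congr 2
  push_cast
  ring

/-! ### Boundary values on the cut and the integral equation -/

theorem cutPoint_eq_one_sub (v : ℝ) : cutPoint v = 1 - 2 * Real.sigmoid v := by
  rw [cutPoint, Real.sigmoid_def, Real.exp_neg]
  field_simp
  ring

theorem cutPoint_injective : Function.Injective cutPoint := fun v w h => by
  rw [cutPoint_eq_one_sub, cutPoint_eq_one_sub] at h
  exact Real.sigmoid_injective (by linarith)

theorem range_cutPoint : range cutPoint = Ioo (-1) 1 := by
  ext u
  have h : u ∈ range cutPoint ↔ (1 - u) / 2 ∈ range Real.sigmoid := by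
    simp_rw [mem_range, cutPoint_eq_one_sub]
    exact exists_congr fun v => ⟨fun h => by linarith, fun h => by linarith⟩
  rw [h, Real.range_sigmoid, mem_Ioo, mem_Ioo]
  constructor <;> rintro ⟨h1, h2⟩ <;> constructor <;> linarith

theorem integral_cutPoint (f : ℝ → ℂ) :
    ∫ r in (-1 : ℝ)..1, f r =
      ∫ v, (2 * Real.exp v / (1 + Real.exp v) ^ 2 : ℝ) * f (cutPoint v) := by
  rw [intervalIntegral.integral_of_le (by norm_num), ← setIntegral_congr_set Ioo_ae_eq_Ioc,
    ← range_cutPoint, ← image_univ, integral_image_eq_integral_abs_deriv_smul MeasurableSet.univ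
      (fun v _ => (hasDerivAt_cutPoint v).hasDerivWithinAt) cutPoint_injective.injOn,
    setIntegral_univ]
  congr 1
  ext v
  rw [neg_div, abs_neg, abs_of_pos (by positivity), Complex.real_smul]

theorem one_sub_cutPoint (v : ℝ) : 1 - cutPoint v = 2 * Real.exp v / (1 + Real.exp v) := by
  rw [cutPoint]; field_simp; ring

theorem one_add_cutPoint (v : ℝ) : 1 + cutPoint v = 2 / (1 + Real.exp v) := by
  rw [cutPoint]; field_simp; ring

/-- Near the cut `Q` is dominated by `|w ^ 2 - 1| ^ (-1/2)`. -/
theorem norm_Q_le (s : ℝ) {ε : ℝ} (hε : 0 < ε) (v : ℝ) :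
    ‖Q s (cutPoint v + ε * Complex.I)‖ ≤ Real.exp (Real.pi * |spectralExponent s|) *
      ((1 + Real.exp v) / (2 * Real.exp (v / 2))) := by
  set w : ℂ := cutPoint v + ε * Complex.I with hw
  set τ := spectralExponent s
  have him : 0 < w.im := by simpa [hw] using hε
  have h1 : 0 < ‖w - 1‖ := norm_pos_iff.2 (sub_one_ne_zero him)
  have h2 : 0 < ‖w + 1‖ := norm_pos_iff.2 (add_one_ne_zero him)
  have h1' : 2 * Real.exp v / (1 + Real.exp v) ≤ ‖w - 1‖ := by
    have hr : (w - 1).re = cutPoint v - 1 := by simp [hw]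
    rw [← one_sub_cutPoint]
    linarith [neg_le_abs (w - 1).re, Complex.abs_re_le_norm (w - 1)]
  have h2' : 2 / (1 + Real.exp v) ≤ ‖w + 1‖ := by
    have hr : (w + 1).re = cutPoint v + 1 := by simp [hw]
    rw [← one_add_cutPoint]
    linarith [Complex.re_le_norm (w + 1)]
  rw [Q_eq_exp_log_cayley s him, norm_div, Complex.norm_exp]
  set z := (w - 1) / (w + 1) with hz
  have hz0 : 0 < ‖z‖ := by rw [hz, norm_div]; positivity
  have hre : ((-(1 / 2) + τ * Complex.I) * Complex.log z).re =
      -(1 / 2) * Real.log ‖z‖ - τ * z.arg := by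
    simp [Complex.log_re, Complex.log_im]
  have harg : -(τ * z.arg) ≤ Real.pi * |τ| := by
    refine (neg_le_abs _).trans ?_
    rw [abs_mul, mul_comm]
    gcongr
    exact Complex.abs_arg_le_pi z
  rw [hre, sub_eq_add_neg, add_comm, Real.exp_add, mul_div_assoc]
  refine mul_le_mul (Real.exp_le_exp.2 harg) ?_ (by positivity) (by positivity)
  refine (abs_le_of_sq_le_sq' ?_ (by positivity)).2
  rw [div_pow, div_pow, mul_pow, ← Real.exp_nat_mul, ← Real.exp_nat_mul,
    show ((2 : ℕ) : ℝ) * (-(1 / 2) * Real.log ‖z‖) = -Real.log ‖z‖ by push_cast; ring,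
    show ((2 : ℕ) : ℝ) * (v / 2) = v by push_cast; ring, Real.exp_neg, Real.exp_log hz0, hz,
    norm_div, inv_div]
  have h3 : ‖w + 1‖ / ‖w - 1‖ / ‖w + 1‖ ^ 2 = (‖w - 1‖ * ‖w + 1‖)⁻¹ := by field_simp
  have h4 : (1 + Real.exp v) ^ 2 / (2 ^ 2 * Real.exp v) =
      (2 * Real.exp v / (1 + Real.exp v) * (2 / (1 + Real.exp v)))⁻¹ := by field_simp
  rw [h3, h4]
  gcongr

/-- The boundary value of `Q` on the upper side of the cut. -/
theorem tendsto_Q_cut (s v : ℝ) :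
    Tendsto (fun ε : ℝ => Q s (cutPoint v + ε * Complex.I)) (𝓝[>] 0)
      (𝓝 (Complex.exp ((-(1 / 2) + spectralExponent s * Complex.I) * (v + Real.pi * Complex.I)) /
        (1 + cutPoint v : ℝ))) := by
  set τ := spectralExponent s
  have hpos : 0 < 1 + cutPoint v := by rw [one_add_cutPoint]; positivity
  have hne : ((cutPoint v : ℂ) + (0 : ℝ) * Complex.I) + 1 ≠ 0 := by
    have : ((1 + cutPoint v : ℝ) : ℂ) ≠ 0 := by exact_mod_cast hpos.ne'
    simpa [add_comm] using this
  have hval : ((cutPoint v : ℂ) + (0 : ℝ) * Complex.I - 1) / ((cutPoint v : ℂ) + (0 : ℝ) * Complex.I + 1) =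
      ((-Real.exp v : ℝ) : ℂ) := by
    rw [div_eq_iff hne]
    have : cutPoint v - 1 = -Real.exp v * (cutPoint v + 1) := by
      have h1 := one_sub_cutPoint v
      have h2 := one_add_cutPoint v
      rw [show cutPoint v - 1 = -(1 - cutPoint v) by ring, h1, add_comm (cutPoint v), h2]; ring
    have := congrArg (fun t : ℝ => (t : ℂ)) this
    push_cast at this ⊢
    linear_combination this
  -- `log` is discontinuous at the limit `-e^v`, which is approached from the upper half-plane
  have hz : Tendsto (fun ε : ℝ => ((cutPoint v : ℂ) + ε * Complex.I - 1) /
      ((cutPoint v : ℂ) + ε * Complex.I + 1)) (𝓝[>] 0)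
      (𝓝[{z : ℂ | 0 ≤ z.im}] ((-Real.exp v : ℝ) : ℂ)) := by
    refine tendsto_nhdsWithin_iff.2 ⟨?_, ?_⟩
    · have hc : ContinuousAt (fun ε : ℝ => ((cutPoint v : ℂ) + ε * Complex.I - 1) /
        ((cutPoint v : ℂ) + ε * Complex.I + 1)) 0 :=
        ContinuousAt.div (by fun_prop) (by fun_prop) hne
      have h := hc.tendsto
      rw [hval] at h
      exact h.mono_left nhdsWithin_le_nhds
    · filter_upwards [self_mem_nhdsWithin] with ε hε
      exact (im_cayley_pos (by simpa using hε)).le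
  have hlog := (Complex.tendsto_log_nhdsWithin_im_nonneg_of_re_neg_of_im_zero
    (z := ((-Real.exp v : ℝ) : ℂ)) 
    (by rw [Complex.ofReal_re]; linarith [Real.exp_pos v]) (by simp)).comp hz
  rw [Complex.norm_real, norm_neg, Real.norm_of_nonneg (Real.exp_pos v).le, Real.log_exp] at hlog
  have hden : Tendsto (fun ε : ℝ => (cutPoint v : ℂ) + ε * Complex.I + 1) (𝓝[>] 0)
      (𝓝 ((1 + cutPoint v : ℝ) : ℂ)) := by
    have hc : Continuous (fun ε : ℝ => (cutPoint v : ℂ) + ε * Complex.I + 1) := by fun_prop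
    have h := (hc.tendsto 0).mono_left (nhdsWithin_le_nhds (s := Ioi 0))
    have e : (cutPoint v : ℂ) + (0 : ℝ) * Complex.I + 1 = ((1 + cutPoint v : ℝ) : ℂ) := by
      push_cast; ring
    rwa [e] at h
  have hexp := (Complex.continuous_exp.tendsto _).comp (hlog.const_mul (-(1 / 2) + τ * Complex.I))
  refine (hexp.div hden (by exact_mod_cast hpos.ne')).congr' ?_
  filter_upwards [self_mem_nhdsWithin] with ε hε
  rw [Q_eq_exp_log_cayley s (by simpa using hε)]
  rfl

theorem tendsto_integral_Q_cut (s x : ℝ) :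
    Tendsto (fun ε : ℝ => ∫ r in (-1 : ℝ)..1,
      Complex.exp (-Complex.I * x * r) * Q s (r + ε * Complex.I)) (𝓝[>] 0)
      (𝓝 (Complex.exp ((-(1 / 2) + spectralExponent s * Complex.I) * (Real.pi * Complex.I)) *
        cutTransform (spectralExponent s) x)) := by
  set τ := spectralExponent s with hτ
  simp_rw [integral_cutPoint]
  rw [cutTransform, ← integral_const_mul]
  have hcp := continuous_cutPoint
  refine tendsto_integral_filter_of_dominated_convergence
    (fun v => Real.exp (Real.pi * |τ|) * (Real.exp (v / 2) / (1 + Real.exp v))) ?_ ?_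
    (integrable_exp_half_div.const_mul _) ?_
  · filter_upwards [self_mem_nhdsWithin] with ε hε
    refine Continuous.aestronglyMeasurable ?_
    refine Continuous.mul (Complex.continuous_ofReal.comp
      (Continuous.div (by fun_prop) (by fun_prop) fun v => by positivity))
      (Continuous.mul (by fun_prop) ?_)
    have him : ∀ v, 0 < ((cutPoint v : ℂ) + ε * Complex.I).im := fun v => by simpa using hε
    simp_rw [fun v => Q_eq_exp_log_cayley s (him v)]
    refine Continuous.div ?_ (by fun_prop) fun v => add_one_ne_zero (him v)
    refine Complex.continuous_exp.comp (continuous_const.mul (Continuous.clog ?_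
      fun v => cayley_mem_slitPlane (him v)))
    exact Continuous.div (by fun_prop) (by fun_prop) fun v => add_one_ne_zero (him v)
  · filter_upwards [self_mem_nhdsWithin] with ε hε
    refine ae_of_all _ fun v => ?_
    rw [norm_mul, norm_mul, norm_cexp_cutPoint, one_mul, Complex.norm_real,
      Real.norm_of_nonneg (by positivity)]
    refine (mul_le_mul_of_nonneg_left (norm_Q_le s hε v) (by positivity)).trans (le_of_eq ?_)
    have : Real.exp v = Real.exp (v / 2) * Real.exp (v / 2) := by rw [← Real.exp_add]; congr 1; ring
    rw [← hτ]
    field_simp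
    rw [this]
    ring
  · refine ae_of_all _ fun v => ?_
    refine (((tendsto_Q_cut s v).const_mul _).const_mul _).trans (le_of_eq ?_)
    congr 1
    rw [← hτ]
    have h0 : (1 + Complex.exp v) ≠ 0 := by
      rw [← Complex.ofReal_exp]; exact_mod_cast (by positivity : (1 + Real.exp v) ≠ 0)
    have h1 : Complex.exp ((1 / 2 + τ * Complex.I) * v) =
        Complex.exp ((-(1 / 2) + τ * Complex.I) * v) * Complex.exp v := by
      rw [← Complex.exp_add]; congr 1; ring
    rw [mul_add, Complex.exp_add, one_add_cutPoint, cutDensity, h1]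
    push_cast
    field_simp

/-- The jump relation `Q₊ = s (Q₊ - Q₋)` on the cut, as an identity between constants. -/
theorem jump_constant {s : ℝ} (hs : s ∈ Ioo (0 : ℝ) 1) :
    Complex.I / (2 * Real.pi) / cutFactor (spectralExponent s) *
      Complex.exp ((-(1 / 2) + spectralExponent s * Complex.I) * (Real.pi * Complex.I)) = s := by
  obtain ⟨h0, h1⟩ := hs
  set τ := spectralExponent s with hτ
  have hpi : (Real.pi : ℂ) ≠ 0 := by exact_mod_cast Real.pi_ne_zero
  have hpos : 0 < 1 / s - 1 := by
    rw [sub_pos, lt_div_iff₀ h0]; linarith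
  set E := Real.exp (Real.pi * τ) with hE
  have hE2 : E * E = 1 / s - 1 := by
    rw [hE, ← Real.exp_add, hτ, spectralExponent,
      show Real.pi * (Real.log (1 / s - 1) / (2 * Real.pi)) +
        Real.pi * (Real.log (1 / s - 1) / (2 * Real.pi)) = Real.log (1 / s - 1) by
          field_simp; ring, Real.exp_log hpos]
  have hE0 : 0 < E := Real.exp_pos _
  have hsin : Complex.sin (Real.pi * (1 / 2 + τ * Complex.I)) = (((E + E⁻¹) / 2 : ℝ) : ℂ) := by
    have : (Real.pi * (1 / 2 + τ * Complex.I) : ℂ) =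
        ((Real.pi * τ : ℝ) : ℂ) * Complex.I + Real.pi / 2 := by push_cast; ring
    rw [this, Complex.sin_add_pi_div_two, Complex.cos_mul_I, ← Complex.ofReal_cosh, Real.cosh_eq,
      Real.exp_neg]
  have hexp : Complex.exp ((-(1 / 2) + τ * Complex.I) * (Real.pi * Complex.I)) =
      -Complex.I * ((E⁻¹ : ℝ) : ℂ) := by
    rw [show (-(1 / 2) + τ * Complex.I) * (Real.pi * Complex.I) =
      -(Real.pi / 2 * Complex.I) + ((-(Real.pi * τ) : ℝ) : ℂ) by
        push_cast; linear_combination (τ * Real.pi : ℂ) * Complex.I_sq,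
      Complex.exp_add, Complex.exp_neg, Complex.exp_pi_div_two_mul_I, Complex.inv_I,
      ← Complex.ofReal_exp, Real.exp_neg]
  rw [cutFactor, hsin, hexp]
  have hreal : E⁻¹ / (E + E⁻¹) = s := by
    have : E⁻¹ / (E + E⁻¹) = 1 / (E * E + 1) := by field_simp
    rw [this, hE2]
    field_simp
    ring
  have hsum : ((E : ℂ) + (E : ℂ)⁻¹) ≠ 0 := by
    have : E + E⁻¹ ≠ 0 := by positivity
    exact_mod_cast this
  have hrealc := congrArg (fun t : ℝ => (t : ℂ)) hreal
  push_cast at hrealc ⊢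
  rw [← hrealc]
  have : Complex.I / (2 * Real.pi) / (((E : ℂ) + (E : ℂ)⁻¹) / 2 / Real.pi) =
      Complex.I / ((E : ℂ) + (E : ℂ)⁻¹) := by
    generalize (E : ℂ) + (E : ℂ)⁻¹ = t at hsum
    field_simp
  rw [this, div_mul_eq_mul_div]
  congr 1
  linear_combination -(E : ℂ)⁻¹ * Complex.I_sq

/-- The integral equation: the factor `e^{-εy}` makes all the integrals absolutely convergent, and
both sides pass to the limit `ε → 0`. -/
theorem integral_sincKernel_mul_cutTransform {s : ℝ} (hs : s ∈ Ioo (0 : ℝ) 1) {x : ℝ}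
    (hx : 0 < x) :
    ∫ y in Ioi (0 : ℝ), (sincKernel (x - y) : ℂ) * cutTransform (spectralExponent s) y =
      s * cutTransform (spectralExponent s) x := by
  set τ := spectralExponent s with hτ
  have hF := integrableOn_sincKernel_mul_cutTransform τ hx
  have hl : Tendsto (fun ε : ℝ => ∫ y in Ioi (0 : ℝ),
      (sincKernel (x - y) : ℂ) * (Complex.exp (-ε * y) * cutTransform τ y)) (𝓝[>] 0)
      (𝓝 (∫ y in Ioi (0 : ℝ), (sincKernel (x - y) : ℂ) * cutTransform τ y)) := by
    simp_rw [mul_left_comm _ (Complex.exp _)]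
    refine tendsto_integral_filter_of_dominated_convergence _ (Eventually.of_forall fun ε =>
      (Continuous.aestronglyMeasurable (by fun_prop)).mul hF.aestronglyMeasurable) ?_ hF.norm
      (ae_of_all _ fun y => ?_)
    · filter_upwards [self_mem_nhdsWithin] with ε hε
      refine (ae_restrict_iff' measurableSet_Ioi).2 (ae_of_all _ fun y hy => ?_)
      rw [norm_mul, norm_cexp_neg_mul]
      refine mul_le_of_le_one_left (norm_nonneg _) (Real.exp_le_one_iff.2 ?_)
      have := mul_pos (mem_Ioi.1 hε) (mem_Ioi.1 hy)
      linarith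
    · have hc : Continuous fun ε : ℝ => Complex.exp (-ε * y) *
          ((sincKernel (x - y) : ℂ) * cutTransform τ y) := by fun_prop
      have h := (hc.tendsto 0).mono_left (nhdsWithin_le_nhds (s := Ioi 0))
      simpa using h
  have hr : Tendsto (fun ε : ℝ => ∫ y in Ioi (0 : ℝ),
      (sincKernel (x - y) : ℂ) * (Complex.exp (-ε * y) * cutTransform τ y)) (𝓝[>] 0)
      (𝓝 (s * cutTransform τ x)) := by
    have h := (tendsto_integral_Q_cut s x).const_mul (Complex.I / (2 * Real.pi) / cutFactor τ)
    rw [← mul_assoc, jump_constant hs] at h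
    refine h.congr' ?_
    filter_upwards [self_mem_nhdsWithin] with ε hε
    have hQ : ∀ r : ℝ, Q s (r + ε * Complex.I) = cutFactor τ *
        ∫ v, cutDensity τ v / (r + ε * Complex.I - cutPoint v) := fun r =>
      Q_eq_cauchy_integral s (by simpa using hε)
    simp_rw [integral_sincKernel_mul_cexp τ hε, hQ, mul_left_comm _ (cutFactor τ)]
    rw [intervalIntegral.integral_const_mul, ← mul_assoc, div_mul_cancel₀ _ (cutFactor_ne_zero τ)]
  exact tendsto_nhds_unique hl hr

theorem isSpectralFunction_qPlus {s : ℝ} (hs : s ∈ Ioo (0 : ℝ) 1) {b : ℝ} (hb : 0 < b) :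
    IsSpectralFunction sincKernel s (qPlus b s) := by
  have hq : ∀ x ∈ Ioi (0 : ℝ), qPlus b s x = spectralFactor s * cutTransform (spectralExponent s) x :=
    fun x hx => by rw [qPlus_eq hb s (ne_of_gt hx), if_pos (mem_Ioi.1 hx)]
  refine ⟨?_, fun x hx => ?_⟩
  · have h := (continuous_cutTransform (spectralExponent s)).continuousAt.eventually_ne
      (cutTransform_zero_ne_zero (spectralExponent s))
    obtain ⟨x, hx, hx0⟩ := ((h.filter_mono (nhdsWithin_le_nhds (s := Ioi 0))).and
      self_mem_nhdsWithin).exists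
    exact ⟨x, hx0, by rw [hq x hx0]; exact mul_ne_zero (spectralFactor_ne_zero s) hx⟩
  · have heq : EqOn (fun y => spectralFactor s *
        ((sincKernel (x - y) : ℂ) * cutTransform (spectralExponent s) y))
        (fun y => (sincKernel (x - y) : ℂ) * qPlus b s y) (Ioi 0) := fun y hy => by
      simp only [hq y hy]; ring
    have hint : IntegrableOn (fun y => spectralFactor s *
        ((sincKernel (x - y) : ℂ) * cutTransform (spectralExponent s) y)) (Ioi 0) :=
      (integrableOn_sincKernel_mul_cutTransform _ hx).const_mul (spectralFactor s)
    refine ⟨hint.congr_fun heq measurableSet_Ioi, ?_⟩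
    rw [← setIntegral_congr_fun measurableSet_Ioi heq, integral_const_mul,
      integral_sincKernel_mul_cutTransform hs hx, hq x hx]
    ring

end SincWienerHopf

theorem mainTheorem3 (s : ℝ) (hs : s ∈ Set.Ioo (0 : ℝ) 1) (b : ℝ) (hb : 0 < b) :
    -- the improper integral defining `q_s^+` converges, and its value does not depend on `b`
    (∀ x : ℝ, x ≠ 0 →
      Tendsto (fun p : ℝ × ℝ => SincWienerHopf.qTrunc b s x p.1 p.2) (atTop ×ˢ atTop)
        (𝓝 (SincWienerHopf.qPlus b s x))) ∧
    (∀ b' : ℝ, 0 < b' → ∀ x : ℝ, x ≠ 0 →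
      SincWienerHopf.qPlus b' s x = SincWienerHopf.qPlus b s x) ∧
    -- the integral equation, in which the integral exists
    (∀ x : ℝ, 0 < x →
      IntegrableOn (fun y => ((1 / Real.pi * Real.sinc (x - y) : ℝ) : ℂ) *
        SincWienerHopf.qPlus b s y) (Ioi 0) ∧
      ∫ y in Ioi (0 : ℝ), ((1 / Real.pi * Real.sinc (x - y) : ℝ) : ℂ) *
        SincWienerHopf.qPlus b s y = (s : ℂ) * SincWienerHopf.qPlus b s x) ∧
    SincWienerHopf.IsSpectralFunction SincWienerHopf.sincKernel s (SincWienerHopf.qPlus b s) := by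
  have hspec := SincWienerHopf.isSpectralFunction_qPlus hs hb
  refine ⟨fun x hx => ?_, fun b' hb' x hx => ?_, fun x hx => ?_, hspec⟩
  · rw [SincWienerHopf.qPlus_eq hb s hx]
    exact SincWienerHopf.tendsto_qTrunc hb s hx
  · rw [SincWienerHopf.qPlus_eq hb s hx, SincWienerHopf.qPlus_eq hb' s hx]
  · obtain ⟨h1, h2⟩ := hspec.2 x hx
    exact ⟨h1, (sub_eq_zero.1 h2).symm⟩
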